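/- Let $G_A$ be a real Banach--Lie group with a Banach--Lie subgroup $G_B$ (a subgroup that is a split submanifold). Let $\mathcal H_A$ be a complex Hilbert space with a closed subspace $\mathcal H_B$, and let $\rho_A\colon G_A\to\mathcal B(\mathcal H_A)$, $\rho_B\colon G_B\to\mathcal B(\mathcal H_B)$ be uniformly (that is, operator-norm) continuous unitary representations such that $\rho_B(w)=\rho_A(w)|_{\mathcal H_B}$ for all $w\in G_B$ and $\mathcal H_A=\overline{\operatorname{span}}\,\rho_A(G_A)\mathcal H_B$. Let $P\colon\mathcal H_A\to\mathcal H_B$ be the orthogonal projection. Give $Z=G_A/G_B$ the smooth Banach manifold structure for which $G_A\to Z$ is a submersion. Let $\Pi\colon D=G_A\times_{G_B}\mathcal H_B\to Z$ be the homogeneous vector bundle, where $D$ is the quotient of $G_A\times\mathcal H_B$ by $(u,f)\sim(uw,\rho_B(w^{-1})f)$, $w\in G_B$, with the local trivializations $(s,f)\mapsto[(\sigma(s),f)]$ given by smooth local sections $\sigma$ of $G_A\to Z$, and with the scalar products $([(u,f)]\mid[(u,h)])_{uG_B}=(f\mid h)$ on its fibers $D_s=\Pi^{-1}(s)$. Then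 $\Pi$ is a Hermitian bundle: a smooth Banach vector bundle whose fibers are complex Hilbert spaces and whose scalar products are smooth in each trivialization. The formula $$K_\rho(uG_B,vG_B)[(v,f)]=[(u,\,P\rho_A(u^{-1})\rho_A(v)f)]\qquad(u,v\in G_A,\ f\in\mathcal H_B)$$ gives well-defined operators $K_\rho(s,t)\colon D_t\to D_s$ ($s,t\in Z$), and $K=K_\rho$ is an admissible reproducing kernel on $\Pi$. That is: 1. The operators $K(s,t)\colon D_t\to D_s$ are bounded and form a continuous section of the bundle $\operatorname{Hom}(p_2^*\Pi,p_1^*\Pi)\to Z\times Z$, where $p_1,p_2\colon Z\times Z\to Z$ are the projections; and $\sum_{j,l=1}^n (K(t_l,t_j)\eta_j\mid\eta_l)_{t_l}\ge 0$ for all $n\ge1$, $t_j\in Z$, $\eta_j\in D_{t_j}$. 2. $K$ is a smooth section of $\operatorname{Hom}(p_2^*\Pi,p_1^*\Pi)$. 3. For every $s\in Z$ the operator $K(s,s)$ is invertible; in fact $K(s,s)=\mathrm{id}_{D_s}$. 4. The map $\zeta_K\colon Z\to\mathrm{Gr}(\mathcal H^K)$, $\zeta_K(s)=\overline{\{K_\xi:\xi\in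 D_s\}}$, is smooth. Here $K_\xi=K(\cdot,\Pi(\xi))\xi$ for $\xi\in D$; $\mathcal H^K$ is the Hilbert space completion of $\operatorname{span}\{K_\xi:\xi\in D\}$ for the scalar product with $(K_\xi\mid K_\eta)=(K(\Pi(\eta),\Pi(\xi))\xi\mid\eta)_{\Pi(\eta)}$; and $\mathrm{Gr}(\mathcal H^K)$ is the Banach manifold of all its closed subspaces. -/

import Mathlib

open scoped Manifold ContDiff Topology
open Bundle

noncomputable section

/-! ### The Grassmann manifold of a complex Hilbert space -/

section Grassmannian

/-- The set of all closed linear subspaces of `H`. -/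
def Gr (H : Type*) [NormedAddCommGroup H] [InnerProductSpace ℂ H] : Type _ :=
  {S : Submodule ℂ H // IsClosed (S : Set H)}

namespace Gr

variable {H : Type*} [NormedAddCommGroup H] [InnerProductSpace ℂ H] [CompleteSpace H]

instance (S : Gr H) : CompleteSpace S.1 := S.2.completeSpace_coe

/-- The domain of the chart of `Gr H` centered at `S`: all closed complements of `Sᗮ`. -/
def chartDomain (S : Gr H) : Set (Gr H) := {T | IsCompl T.1 S.1ᗮ}

/-- The chart of `Gr H` centered at `S`: an element `T` of its domain is the graph of a unique
bounded operator `A : S → Sᗮ`, namely `A = (p_{Sᗮ}|_T) ∘ (p_S|_T)⁻¹`, and the chart sends `T` to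
`A`. (The value outside `chartDomain S` is irrelevant.) -/
def chart (S T : Gr H) : S.1 →L[ℂ] S.1ᗮ :=
  (S.1ᗮ.orthogonalProjectionOnto ∘L T.1.subtypeL) ∘L
    (S.1.orthogonalProjectionOnto ∘L T.1.subtypeL).inverse

/-- Smoothness (over the reals) of a map from a manifold modelled on the Banach space `M` into the
Grassmann manifold: the preimage of each chart domain is open, and there the map is smooth when
read in that chart. -/
def IsSmoothMap {M : Type*} [NormedAddCommGroup M] [NormedSpace ℝ M]
    {Z : Type*} [TopologicalSpace Z] [ChartedSpace M Z] (ζ : Z → Gr H) : Prop :=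
  ∀ S : Gr H, IsOpen (ζ ⁻¹' chartDomain S) ∧
    ContMDiffOn 𝓘(ℝ, M) 𝓘(ℝ, S.1 →L[ℂ] S.1ᗮ) ∞ (fun z => chart S (ζ z)) (ζ ⁻¹' chartDomain S)

end Gr

end Grassmannian

/-! ### Positive definite kernels and their Hilbert spaces of sections -/

section PosDef

variable {Z : Type*} {D : Z → Type*} [∀ z, NormedAddCommGroup (D z)]
  [∀ z, InnerProductSpace ℂ (D z)]

/-- A kernel on the family of Hilbert spaces `D`: bounded operators `K s t : D t → D s`. -/
abbrev BundleKernel (D : Z → Type*) [∀ z, NormedAddCommGroup (D z)]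
    [∀ z, InnerProductSpace ℂ (D z)] : Type _ :=
  ∀ s t : Z, D t →L[ℂ] D s

namespace BundleKernel

open scoped ComplexOrder in
/-- Positive definiteness: `∑ j l, (K(t_l, t_j) η_j ∣ η_l) ≥ 0`. The scalar product `(x ∣ y)`,
which is linear in its first variable, is Mathlib's `inner ℂ y x`. -/
def IsPosDef (K : BundleKernel D) : Prop :=
  ∀ (n : ℕ) (t : Fin n → Z) (η : ∀ j, D (t j)),
    0 ≤ ∑ j, ∑ l, inner ℂ (η l) (K (t l) (t j) (η j))

/-- The section `K_ξ = K(·, t) ξ` attached to `ξ ∈ D t`. -/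
def sectionAt (K : BundleKernel D) (t : Z) : D t →ₗ[ℂ] (∀ s, D s) :=
  LinearMap.pi fun s => (K s t : D t →ₗ[ℂ] D s)

@[simp] theorem sectionAt_apply (K : BundleKernel D) (t : Z) (ξ : D t) (s : Z) :
    K.sectionAt t ξ s = K s t ξ := rfl

/-- The linear span of the sections `K_ξ`. -/
def sectionSpan (K : BundleKernel D) : Submodule ℂ (∀ s, D s) :=
  Submodule.span ℂ {σ | ∃ (t : Z) (ξ : D t), σ = K.sectionAt t ξ}

/-- The finite sum `K_{ξ_1} + ⋯ + K_{ξ_n}`. -/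
def listSum (K : BundleKernel D) (l : List (Σ z, D z)) : ∀ s, D s :=
  (l.map fun ξ => K.sectionAt ξ.1 ξ.2).sum

/-- The finite sum of the scalar products `(f(t_j) ∣ ξ_j)`, where `ξ_j ∈ D t_j`. -/
def listPair (l : List (Σ z, D z)) (f : ∀ s, D s) : ℂ :=
  (l.map fun ξ => inner ℂ ξ.2 (f ξ.1)).sum

variable {K : BundleKernel D}

theorem exists_listSum {f : ∀ s, D s} (hf : f ∈ K.sectionSpan) :
    ∃ l, K.listSum l = f := by
  induction hf using Submodule.span_induction with
  | mem x hx =>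
    obtain ⟨t, ξ, rfl⟩ := hx
    exact ⟨[⟨t, ξ⟩], by simp [listSum]⟩
  | zero => exact ⟨[], by simp [listSum]⟩
  | add x y _ _ hx hy =>
    obtain ⟨l, rfl⟩ := hx
    obtain ⟨l', rfl⟩ := hy
    exact ⟨l ++ l', by simp [listSum]⟩
  | smul a x _ hx =>
    obtain ⟨l, rfl⟩ := hx
    refine ⟨l.map fun ξ => ⟨ξ.1, a • ξ.2⟩, ?_⟩
    clear * -
    induction l with
    | nil => simp [listSum]
    | cons b l ih => simp_all [listSum]

theorem listPair_add (l : List (Σ z, D z)) (f g : ∀ s, D s) :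
    listPair l (f + g) = listPair l f + listPair l g := by
  induction l with
  | nil => simp [listPair]
  | cons b l ih =>
    simp only [listPair, List.map_cons, List.sum_cons, Pi.add_apply, inner_add_right] at ih ⊢
    rw [ih]; ring

theorem listPair_smul (l : List (Σ z, D z)) (c : ℂ) (f : ∀ s, D s) :
    listPair l (c • f) = c * listPair l f := by
  induction l with
  | nil => simp [listPair]
  | cons b l ih =>
    simp only [listPair, List.map_cons, List.sum_cons, Pi.smul_apply, inner_smul_right] at ih ⊢
    rw [ih]; ring

namespace IsPosDef

theorem inner_symm (hK : K.IsPosDef) {s t : Z} (ξ : D t) (η : D s) :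
    (starRingEnd ℂ) (inner ℂ ξ (K t s η)) = inner ℂ η (K s t ξ) := by
  have key : ∀ (ξ : D t) (η : D s),
      (inner ℂ ξ (K t s η) + inner ℂ η (K s t ξ)).im = 0 := by
    intro ξ η
    have h1 := (Complex.le_def.1 (hK 1 (fun _ => t) (fun _ => ξ))).2
    have h2 := (Complex.le_def.1 (hK 1 (fun _ => s) (fun _ => η))).2
    let τ : Fin 2 → Z := Fin.cons t (fun _ => s)
    let θ : ∀ j, D (τ j) := Fin.cons (α := fun j => D (τ j)) ξ (fun _ => η)
    have h3 := (Complex.le_def.1 (hK 2 τ θ)).2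
    simp only [Fin.sum_univ_two, Fin.sum_univ_one] at h1 h2 h3
    change _ = (inner ℂ ξ (K t t ξ) + inner ℂ η (K s t ξ) +
      (inner ℂ ξ (K t s η) + inner ℂ η (K s s η))).im at h3
    simp only [Complex.add_im, Complex.zero_im] at h1 h2 h3 ⊢
    linarith
  have h1 := key ξ η
  have h2 := key (Complex.I • ξ) η
  simp only [map_smul, inner_smul_left, inner_smul_right, Complex.conj_I] at h2
  simp at h1 h2
  apply Complex.ext
  · rw [Complex.conj_re]; linarith
  · rw [Complex.conj_im]; linarith

theorem listPair_symm (hK : K.IsPosDef) (l l' : List (Σ z, D z)) :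
    (starRingEnd ℂ) (listPair l (K.listSum l')) = listPair l' (K.listSum l) := by
  have h1 : ∀ (ξ : Σ z, D z) (l : List (Σ z, D z)),
      (starRingEnd ℂ) (listPair l (K.sectionAt ξ.1 ξ.2)) = inner ℂ ξ.2 (K.listSum l ξ.1) := by
    intro ξ l
    induction l with
    | nil => simp [listPair, listSum]
    | cons b l ih =>
      simp only [listPair, listSum, List.map_cons, List.sum_cons, Pi.add_apply, inner_add_right,
        map_add, sectionAt_apply] at ih ⊢
      rw [ih, hK.inner_symm]
  induction l' with
  | nil =>
    have : listPair l (0 : ∀ s, D s) = 0 := by simpa using listPair_smul l 0 0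
    simp [listPair, listSum] at this ⊢
  | cons b l' ih =>
    have e : K.listSum (b :: l') = K.sectionAt b.1 b.2 + K.listSum l' := by simp [listSum]
    rw [e, listPair_add, map_add, h1, ih]
    simp [listPair]

theorem listPair_self_nonneg (hK : K.IsPosDef) (l : List (Σ z, D z)) :
    0 ≤ (listPair l (K.listSum l)).re := by
  have h := (Complex.le_def.1 (hK l.length (fun j => (l.get j).1) (fun j => (l.get j).2))).1
  have e : listPair l (K.listSum l) = ∑ j : Fin l.length, ∑ i : Fin l.length,
      inner ℂ (l.get i).2 (K (l.get i).1 (l.get j).1 (l.get j).2) := by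
    rw [Finset.sum_comm]
    have : ∀ g : (Σ z, D z) → ℂ, (l.map g).sum = ∑ i : Fin l.length, g (l.get i) := by
      intro g
      rw [← List.sum_ofFn]
      congr 1
      exact (List.ofFn_get (l.map g) ▸ by
        apply List.ext_get <;> simp)
    rw [listPair, this]
    refine Finset.sum_congr rfl fun i _ => ?_
    rw [← inner_sum]
    congr 1
    have h2 : ∀ (l' : List (Σ z, D z)) (s : Z),
        K.listSum l' s = ∑ j : Fin l'.length, K s (l'.get j).1 (l'.get j).2 := by
      intro l' s
      induction l' with
      | nil => simp [listSum]
      | cons b l' ih =>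
        simp only [listSum, List.map_cons, List.sum_cons, Pi.add_apply, sectionAt_apply] at ih ⊢
        rw [ih]
        exact (Fin.sum_univ_succ (fun j : Fin (l'.length + 1) =>
          K s ((b :: l').get j).1 ((b :: l').get j).2)).symm
    exact h2 l _
  rw [e]; simpa using h

/-- The space `span {K_ξ}` of sections, as the carrier of its pre-Hilbert space structure. -/
def PreSpace (_hK : K.IsPosDef) : Type _ := K.sectionSpan

instance (hK : K.IsPosDef) : AddCommGroup hK.PreSpace :=
  inferInstanceAs (AddCommGroup K.sectionSpan)

instance (hK : K.IsPosDef) : Module ℂ hK.PreSpace :=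
  inferInstanceAs (Module ℂ K.sectionSpan)

/-- The scalar product on `span {K_ξ}` determined by
`(K_ξ ∣ K_η) = (K(t, s) ξ ∣ η)` for `ξ ∈ D s`, `η ∈ D t`; see `inner_kernelSection`.
It is computed as `(f ∣ ∑ j, K_{ξ_j}) = ∑ j, (f(t_j) ∣ ξ_j)`. -/
instance (hK : K.IsPosDef) : Inner ℂ hK.PreSpace :=
  ⟨fun g f => listPair (exists_listSum g.2).choose f.1⟩

theorem inner_eq (hK : K.IsPosDef) (l : List (Σ z, D z)) (g f : hK.PreSpace)
    (hl : K.listSum l = g.1) : inner ℂ g f = listPair l f.1 := by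
  obtain ⟨l', hl'⟩ := exists_listSum f.2
  have h := (exists_listSum g.2).choose_spec
  change listPair (exists_listSum g.2).choose f.1 = _
  rw [← hl', ← hK.listPair_symm, h, ← hK.listPair_symm l' l, hl]

instance core (hK : K.IsPosDef) : PreInnerProductSpace.Core ℂ hK.PreSpace where
  conj_inner_symm x y := by
    obtain ⟨l, hl⟩ := exists_listSum x.2
    obtain ⟨l', hl'⟩ := exists_listSum y.2
    rw [hK.inner_eq l x y hl, hK.inner_eq l' y x hl', ← hl, ← hl', hK.listPair_symm]
  re_inner_nonneg x := by
    obtain ⟨l, hl⟩ := exists_listSum x.2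
    rw [hK.inner_eq l x x hl, ← hl]
    exact hK.listPair_self_nonneg l
  add_left x y z := by
    obtain ⟨l, hl⟩ := exists_listSum x.2
    obtain ⟨l', hl'⟩ := exists_listSum y.2
    have : K.listSum (l ++ l') = (x + y).1 := by
      change _ = x.1 + y.1
      rw [← hl, ← hl']; simp [listSum]
    rw [hK.inner_eq l x z hl, hK.inner_eq l' y z hl', hK.inner_eq _ (x + y) z this]
    simp [listPair]
  smul_left x y r := by
    obtain ⟨l, hl⟩ := exists_listSum x.2
    obtain ⟨l', hl'⟩ := exists_listSum y.2
    obtain ⟨l'', hl''⟩ := exists_listSum (r • x).2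
    rw [hK.inner_eq l x y hl, hK.inner_eq l'' _ y hl'', ← hl', ← hK.listPair_symm,
      ← hK.listPair_symm l' l, hl, hl'', ← map_mul, ← listPair_smul]
    rfl

theorem inner_definite (hK : K.IsPosDef) (x : hK.PreSpace) (hx : inner ℂ x x = 0) : x = 0 := by
  apply Subtype.ext
  funext t
  change x.1 t = 0
  set y : hK.PreSpace := ⟨K.sectionAt t (x.1 t), Submodule.subset_span ⟨t, _, rfl⟩⟩ with hy
  have h1 : inner ℂ y x = inner ℂ (x.1 t) (x.1 t) := by
    rw [hK.inner_eq [⟨t, x.1 t⟩] y x (by simp [listSum, hy])]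
    simp [listPair]
  have h2 := InnerProductSpace.Core.inner_mul_inner_self_le (𝕜 := ℂ) y x
  rw [hx, ← (hK.core).conj_inner_symm x y, RCLike.norm_conj, h1] at h2
  simp only [map_zero, mul_zero] at h2
  have h3 : ‖inner ℂ (x.1 t) (x.1 t)‖ = 0 := by nlinarith [norm_nonneg (inner ℂ (x.1 t) (x.1 t))]
  simpa using h3

instance (hK : K.IsPosDef) : NormedAddCommGroup hK.PreSpace :=
  InnerProductSpace.Core.toNormedAddCommGroup (𝕜 := ℂ)
    (cd := { hK.core with definite := hK.inner_definite })

instance (hK : K.IsPosDef) : InnerProductSpace ℂ hK.PreSpace :=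
  InnerProductSpace.ofCore hK.core

/-- The Hilbert space of a positive definite kernel: the completion of `span {K_ξ}`. -/
abbrev Space (hK : K.IsPosDef) : Type _ := UniformSpace.Completion hK.PreSpace

/-- `K_ξ` as an element of `span {K_ξ}`, linearly in `ξ ∈ D t`. -/
def kernelSection (hK : K.IsPosDef) (t : Z) : D t →ₗ[ℂ] hK.PreSpace :=
  LinearMap.codRestrict K.sectionSpan (K.sectionAt t)
    fun ξ => Submodule.subset_span ⟨t, ξ, rfl⟩

theorem inner_kernelSection (hK : K.IsPosDef) {s t : Z} (ξ : D s) (η : D t) :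
    inner ℂ (hK.kernelSection t η) (hK.kernelSection s ξ) = inner ℂ η (K t s ξ) := by
  rw [hK.inner_eq [⟨t, η⟩] _ _ (by simp [listSum]; rfl)]
  simp [listPair]
  rfl

/-- The map `ξ ↦ K_ξ` from the fiber `D t` into the Hilbert space of the kernel. -/
def toSpace (hK : K.IsPosDef) (t : Z) : D t →ₗ[ℂ] hK.Space :=
  (UniformSpace.Completion.toComplL (𝕜 := ℂ) (E := hK.PreSpace) : _ →ₗ[ℂ] _) ∘ₗ hK.kernelSection t

/-- The map `ζ_K`, which sends `s` to the closure of the image of the fiber `D s` in the Hilbert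
space of the kernel. -/
def zeta (hK : K.IsPosDef) (s : Z) : Gr hK.Space :=
  ⟨(LinearMap.range (hK.toSpace s)).topologicalClosure,
    Submodule.isClosed_topologicalClosure _⟩

end IsPosDef

end BundleKernel

end PosDef

/-! ### Hermitian bundles and admissible reproducing kernels -/

section Hermitian

variable {M : Type*} [NormedAddCommGroup M] [NormedSpace ℝ M]
  {Z : Type*} [TopologicalSpace Z] [ChartedSpace M Z]
  (F : Type*) [NormedAddCommGroup F] [InnerProductSpace ℂ F]
  (D : Z → Type*) [∀ z, NormedAddCommGroup (D z)] [∀ z, InnerProductSpace ℂ (D z)]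
  [TopologicalSpace (TotalSpace F D)] [FiberBundle F D] [VectorBundle ℂ F D]

/-- A smooth Banach vector bundle with a Hermitian structure. The base `Z` is a smooth Banach
manifold modelled on `M`, and `D` is a topological vector bundle with typical fiber the complex
Hilbert space `F`. -/
structure IsHermitianBundle [CompleteSpace M] [IsManifold 𝓘(ℝ, M) ∞ Z] [CompleteSpace F] :
    Prop where
  /-- The transition functions of the bundle are smooth with respect to the operator norm. -/
  smooth_coordChange : ∀ (e e' : Trivialization F (π F D)) [MemTrivializationAtlas e]
    [MemTrivializationAtlas e'],
      ContMDiffOn 𝓘(ℝ, M) 𝓘(ℝ, F →L[ℂ] F) ∞ (fun z => (e.coordChangeL ℂ e' z : F →L[ℂ] F))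
        (e.baseSet ∩ e'.baseSet)
  /-- Each fiber is a complex Hilbert space. -/
  complete_fiber : ∀ z, CompleteSpace (D z)
  /-- The scalar product of the fibers is smooth in each trivialization. -/
  smooth_inner : ∀ (e : Trivialization F (π F D)) [MemTrivializationAtlas e],
    ContMDiffOn (𝓘(ℝ, M).prod (𝓘(ℝ, F).prod 𝓘(ℝ, F))) 𝓘(ℝ, ℂ) ∞
      (fun q : Z × F × F => inner ℂ (e.symmL ℂ q.1 q.2.2) (e.symmL ℂ q.1 q.2.1))
      (e.baseSet ×ˢ Set.univ)

variable {D}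

/-- The section `(s, t) ↦ K(s, t)` of the bundle `Hom(p₂^* D, p₁^* D)` over `Z × Z`, read in
trivializations `e` of `D` near `s` and `e'` of `D` near `t`. -/
def BundleKernel.inTrivializations (K : BundleKernel D) (e e' : Trivialization F (π F D))
    [MemTrivializationAtlas e] [MemTrivializationAtlas e'] (p : Z × Z) : F →L[ℂ] F :=
  e.continuousLinearMapAt ℂ p.1 ∘L K p.1 p.2 ∘L e'.symmL ℂ p.2

/-- A reproducing kernel on `D`: a continuous section of `Hom(p₂^* D, p₁^* D)` that is
positive definite. -/
structure IsReproducingKernel (K : BundleKernel D) : Prop where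
  continuous_section : ∀ (e e' : Trivialization F (π F D)) [MemTrivializationAtlas e]
    [MemTrivializationAtlas e'],
      ContinuousOn (K.inTrivializations F e e') (e.baseSet ×ˢ e'.baseSet)
  posDef : K.IsPosDef

/-- An admissible reproducing kernel on `D`. -/
structure IsAdmissibleKernel (K : BundleKernel D) : Prop extends IsReproducingKernel F K where
  /-- `K` is a smooth section of `Hom(p₂^* D, p₁^* D)`. -/
  smooth_section : ∀ (e e' : Trivialization F (π F D)) [MemTrivializationAtlas e]
    [MemTrivializationAtlas e'],
      ContMDiffOn (𝓘(ℝ, M).prod 𝓘(ℝ, M)) 𝓘(ℝ, F →L[ℂ] F) ∞ (K.inTrivializations F e e')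
        (e.baseSet ×ˢ e'.baseSet)
  /-- `K(s, s)` is an invertible operator on `D s`. -/
  isUnit_diag : ∀ s, IsUnit (K s s)
  /-- `ζ_K` is a smooth map into the Grassmann manifold of the Hilbert space of `K`. -/
  smooth_zeta : Gr.IsSmoothMap (M := M) posDef.zeta

end Hermitian
/-! ### Banach-Lie subgroups and their homogeneous spaces -/

section Quotient

variable (E : Type*) [NormedAddCommGroup E] [NormedSpace ℝ E]
  {G : Type*} [Group G] [TopologicalSpace G] [ChartedSpace E G]

/-- A Banach-Lie subgroup of a Banach-Lie group `G` modelled on `E`: a subgroup that is a (split)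
submanifold, which means that around each of its points some chart of `G` maps the subgroup to a
closed complemented linear subspace. -/
class IsBanachLieSubgroup (H : Subgroup G) : Prop where
  exists_chart : ∀ h ∈ H, ∃ φ ∈ IsManifold.maximalAtlas 𝓘(ℝ, E) ∞ G, ∃ F : Submodule ℝ E,
    F.ClosedComplemented ∧ h ∈ φ.source ∧ ∀ g ∈ φ.source, (g ∈ H ↔ φ g ∈ F)

/-- The model space of `G ⧸ H`: a closed complement in `E` of the model space of `H`. -/
def quotientModel (H : Subgroup G) [hH : IsBanachLieSubgroup E H] : Submodule ℝ E :=
  LinearMap.ker (hH.exists_chart 1 H.one_mem).choose_spec.2.choose_spec.1.choose.toLinearMap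

instance (H : Subgroup G) [hH : IsBanachLieSubgroup E H] [CompleteSpace E] :
    CompleteSpace (quotientModel E H) :=
  (ContinuousLinearMap.isClosed_ker
    (hH.exists_chart 1 H.one_mem).choose_spec.2.choose_spec.1.choose).completeSpace_coe

variable {E}

/-- The charts of the canonical manifold structure of `G ⧸ H`: those homeomorphisms between open
subsets of `G ⧸ H` and of the model space `M` for which the projection `G → G ⧸ H` becomes smooth
and has a smooth section. Thus `G → G ⧸ H` is a submersion for this manifold structure. -/
structure IsQuotientChart {M : Type*} [NormedAddCommGroup M] [NormedSpace ℝ M] (H : Subgroup G)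
    (c : OpenPartialHomeomorph (G ⧸ H) M) : Prop where
  smooth_comp_mk : ContMDiffOn 𝓘(ℝ, E) 𝓘(ℝ, M) ∞ (fun g : G => c (g : G ⧸ H))
    ((fun g : G => (g : G ⧸ H)) ⁻¹' c.source)
  exists_section : ∃ σ : M → G, ContMDiffOn 𝓘(ℝ, M) 𝓘(ℝ, E) ∞ σ c.target ∧
    ∀ x ∈ c.target, (σ x : G ⧸ H) = c.symm x

theorem hasFDerivAt_chart_mul [LieGroup 𝓘(ℝ, E) ∞ G]
    {φ : OpenPartialHomeomorph G E} (hφ : φ ∈ IsManifold.maximalAtlas 𝓘(ℝ, E) ∞ G)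
    (h1 : (1 : G) ∈ φ.source) (A B : E →L[ℝ] E) (hAB : ∀ x, A x + B x = x) :
    HasFDerivAt (fun x => φ (φ.symm (φ 1 + A x) * φ.symm (φ 1 + B x)))
      ((ContinuousLinearEquiv.refl ℝ E : E ≃L[ℝ] E) : E →L[ℝ] E) 0 := by
  have hs := contMDiffOn_symm_of_mem_maximalAtlas hφ
  have hf := contMDiffOn_of_mem_maximalAtlas hφ
  have ht : φ 1 ∈ φ.target := φ.map_source h1
  set μ : E × E → E := fun q => φ (φ.symm (φ 1 + q.1) * φ.symm (φ 1 + q.2)) with hμ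
  have hμd : ContMDiffAt 𝓘(ℝ, E × E) 𝓘(ℝ, E) ∞ μ 0 := by
    have a1 : ContMDiffAt 𝓘(ℝ, E × E) 𝓘(ℝ, E) ∞ (fun q : E × E => φ.symm (φ 1 + q.1)) 0 := by
      have : ContMDiffAt 𝓘(ℝ, E) 𝓘(ℝ, E) ∞ φ.symm (φ 1 + (0 : E × E).1) := by
        simpa using hs.contMDiffAt (φ.open_target.mem_nhds ht)
      exact this.comp (0 : E × E) (contDiffAt_const.add contDiffAt_fst).contMDiffAt
    have a2 : ContMDiffAt 𝓘(ℝ, E × E) 𝓘(ℝ, E) ∞ (fun q : E × E => φ.symm (φ 1 + q.2)) 0 := by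
      have : ContMDiffAt 𝓘(ℝ, E) 𝓘(ℝ, E) ∞ φ.symm (φ 1 + (0 : E × E).2) := by
        simpa using hs.contMDiffAt (φ.open_target.mem_nhds ht)
      exact this.comp (0 : E × E) (contDiffAt_const.add contDiffAt_snd).contMDiffAt
    have a3 := a1.mul a2
    have a4 : ContMDiffAt 𝓘(ℝ, E) 𝓘(ℝ, E) ∞ φ
        (φ.symm (φ 1 + (0 : E × E).1) * φ.symm (φ 1 + (0 : E × E).2)) := by
      have : φ.symm (φ 1 + (0 : E × E).1) * φ.symm (φ 1 + (0 : E × E).2) = 1 := by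
        simp [φ.left_inv h1]
      rw [this]
      exact hf.contMDiffAt (φ.open_source.mem_nhds h1)
    exact a4.comp (0 : E × E) a3
  have hμd' : DifferentiableAt ℝ μ 0 :=
    (contMDiffAt_iff_contDiffAt.1 hμd).differentiableAt (by simp)
  have hev : ∀ᶠ u : E in 𝓝 0, φ 1 + u ∈ φ.target := by
    have : ContinuousAt (fun u : E => φ 1 + u) 0 := by fun_prop
    exact this.eventually (by simpa using φ.open_target.mem_nhds ht)
  have hL1 : ∀ u, fderiv ℝ μ 0 (u, 0) = u := by
    have c1 : HasFDerivAt (fun u : E => μ (u, 0))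
        ((fderiv ℝ μ 0).comp (ContinuousLinearMap.inl ℝ E E)) 0 := by
      have : HasFDerivAt μ (fderiv ℝ μ 0) (ContinuousLinearMap.inl ℝ E E 0) := by
        simpa [← Prod.zero_eq_mk] using hμd'.hasFDerivAt
      exact this.comp (0 : E) (ContinuousLinearMap.inl ℝ E E).hasFDerivAt
    have c2 : HasFDerivAt (fun u : E => μ (u, 0)) (ContinuousLinearMap.id ℝ E) 0 := by
      refine ((hasFDerivAt_id (0 : E)).const_add (φ 1)).congr_of_eventuallyEq ?_
      filter_upwards [hev] with u hu
      simp [hμ, φ.left_inv h1, φ.right_inv hu]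
    intro u
    simpa using congrArg (fun L : E →L[ℝ] E => L u) (c1.unique c2)
  have hL2 : ∀ u, fderiv ℝ μ 0 (0, u) = u := by
    have c1 : HasFDerivAt (fun u : E => μ (0, u))
        ((fderiv ℝ μ 0).comp (ContinuousLinearMap.inr ℝ E E)) 0 := by
      have : HasFDerivAt μ (fderiv ℝ μ 0) (ContinuousLinearMap.inr ℝ E E 0) := by
        simpa [← Prod.zero_eq_mk] using hμd'.hasFDerivAt
      exact this.comp (0 : E) (ContinuousLinearMap.inr ℝ E E).hasFDerivAt
    have c2 : HasFDerivAt (fun u : E => μ (0, u)) (ContinuousLinearMap.id ℝ E) 0 := by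
      refine ((hasFDerivAt_id (0 : E)).const_add (φ 1)).congr_of_eventuallyEq ?_
      filter_upwards [hev] with u hu
      simp [hμ, φ.left_inv h1, φ.right_inv hu]
    intro u
    simpa using congrArg (fun L : E →L[ℝ] E => L u) (c1.unique c2)
  have hfin : HasFDerivAt (fun x => μ (A x, B x)) ((fderiv ℝ μ 0).comp (A.prod B)) 0 := by
    have : HasFDerivAt μ (fderiv ℝ μ 0) ((A.prod B) 0) := by simpa [← Prod.zero_eq_mk] using hμd'.hasFDerivAt
    exact this.comp (0 : E) (A.prod B).hasFDerivAt
  convert hfin using 1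
  ext x
  have : (A x, B x) = (A x, (0 : E)) + ((0 : E), B x) := by simp
  simp only [ContinuousLinearMap.comp_apply, ContinuousLinearMap.prod_apply]
  rw [this, map_add, hL1, hL2, hAB]; rfl

/-- Local product decomposition of `G` near `1` along a Banach-Lie subgroup. -/
theorem exists_slice [CompleteSpace E] [LieGroup 𝓘(ℝ, E) ∞ G]
    {φ : OpenPartialHomeomorph G E} (hφ : φ ∈ IsManifold.maximalAtlas 𝓘(ℝ, E) ∞ G)
    (h1 : (1 : G) ∈ φ.source) (A B : E →L[ℝ] E) (hAB : ∀ x, A x + B x = x) :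
    ∃ (N : Set E) (U : Set G) (r : G → E), IsOpen N ∧ (0 : E) ∈ N ∧ IsOpen U ∧
      (∀ x ∈ N, φ 1 + A x ∈ φ.target ∧ φ 1 + B x ∈ φ.target) ∧
      (∀ x ∈ N, φ.symm (φ 1 + A x) * φ.symm (φ 1 + B x) ∈ U ∧
        r (φ.symm (φ 1 + A x) * φ.symm (φ 1 + B x)) = x) ∧
      (∀ g ∈ U, r g ∈ N ∧ φ.symm (φ 1 + A (r g)) * φ.symm (φ 1 + B (r g)) = g) ∧
      ContMDiffOn 𝓘(ℝ, E) 𝓘(ℝ, E) ∞ r U := by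
  have hs := contMDiffOn_symm_of_mem_maximalAtlas hφ
  have hf := contMDiffOn_of_mem_maximalAtlas hφ
  have ht : φ 1 ∈ φ.target := φ.map_source h1
  set Ψ : E → G := fun x => φ.symm (φ 1 + A x) * φ.symm (φ 1 + B x) with hΨ
  set S1 : Set E := {x | φ 1 + A x ∈ φ.target ∧ φ 1 + B x ∈ φ.target} with hS1
  have hS1o : IsOpen S1 :=
    (φ.open_target.preimage (by fun_prop : Continuous fun x => φ 1 + A x)).inter
      (φ.open_target.preimage (by fun_prop : Continuous fun x => φ 1 + B x))
  have hΨs : ContMDiffOn 𝓘(ℝ, E) 𝓘(ℝ, E) ∞ Ψ S1 := by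
    refine ContMDiffOn.mul (hs.comp ?_ fun x hx => hx.1) (hs.comp ?_ fun x hx => hx.2)
    · exact (contDiff_const.add A.contDiff).contMDiff.contMDiffOn
    · exact (contDiff_const.add B.contDiff).contMDiff.contMDiffOn
  set S : Set E := S1 ∩ Ψ ⁻¹' φ.source with hS
  have hSo : IsOpen S := hΨs.continuousOn.isOpen_inter_preimage hS1o φ.open_source
  have h0S : (0 : E) ∈ S := by
    refine ⟨⟨by simpa using ht, by simpa using ht⟩, ?_⟩
    simpa [hΨ, φ.left_inv h1] using h1
  have hψs : ContDiffOn ℝ ∞ (fun x => φ (Ψ x)) S :=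
    contMDiffOn_iff_contDiffOn.1 (hf.comp (hΨs.mono Set.inter_subset_left) fun x hx => hx.2)
  have hψ0 : ContDiffAt ℝ ∞ (fun x => φ (Ψ x)) 0 := hψs.contDiffAt (hSo.mem_nhds h0S)
  have hd := hasFDerivAt_chart_mul hφ h1 A B hAB
  set e := hψ0.toOpenPartialHomeomorph (fun x => φ (Ψ x)) hd (by simp) with he
  have hec : ∀ x, e x = φ (Ψ x) := fun x => rfl
  have h0e : (0 : E) ∈ e.source := hψ0.mem_toOpenPartialHomeomorph_source hd (by simp)
  have hcont : ContinuousOn (fderiv ℝ (fun x => φ (Ψ x))) S :=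
    hψs.continuousOn_fderiv_of_isOpen hSo (by simp)
  set R : Set (E →L[ℝ] E) := Set.range ContinuousLinearEquiv.toContinuousLinearMap with hR
  have hRo : IsOpen R := ContinuousLinearEquiv.isOpen
  set N : Set E := (S ∩ fderiv ℝ (fun x => φ (Ψ x)) ⁻¹' R) ∩ e.source with hN
  have hNo : IsOpen N := (hcont.isOpen_inter_preimage hSo hRo).inter e.open_source
  have h0N : (0 : E) ∈ N := ⟨⟨h0S, by rw [Set.mem_preimage, hd.fderiv]; exact ⟨_, rfl⟩⟩, h0e⟩
  have heN : IsOpen (e '' N) := e.isOpen_image_of_subset_source hNo Set.inter_subset_right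
  refine ⟨N, φ.source ∩ φ ⁻¹' (e '' N), fun g => e.symm (φ g), hNo, h0N,
    φ.isOpen_inter_preimage heN, fun x hx => hx.1.1.1, ?_, ?_, ?_⟩
  · intro x hx
    refine ⟨⟨hx.1.1.2, x, hx, rfl⟩, ?_⟩
    exact e.left_inv hx.2
  · rintro g ⟨hg, x, hx, hxg⟩
    have : e.symm (φ g) = x := by rw [← hxg, e.left_inv hx.2]
    simp only [this]
    refine ⟨hx, ?_⟩
    have h2 : φ.symm (φ (Ψ x)) = Ψ x := φ.left_inv hx.1.1.2
    rw [hec] at hxg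
    rw [hxg, φ.left_inv hg] at h2
    exact h2.symm
  · have : ContDiffOn ℝ ∞ e.symm (e '' N) := by
      rintro y ⟨x, hx, rfl⟩
      obtain ⟨L, hL⟩ := hx.1.2
      have hxd : ContDiffAt ℝ ∞ (fun x => φ (Ψ x)) x := hψs.contDiffAt (hSo.mem_nhds hx.1.1)
      refine (e.contDiffAt_symm (f₀' := L) (e.map_source hx.2) ?_ ?_).contDiffWithinAt
      · rw [e.left_inv hx.2, hL]
        exact (hxd.differentiableAt (by simp)).hasFDerivAt
      · rw [e.left_inv hx.2]; exact hxd
    exact (contMDiffOn_iff_contDiffOn.2 this).comp (hf.mono Set.inter_subset_left)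
      fun g hg => hg.2

theorem exists_quotientChart_one [CompleteSpace E] [LieGroup 𝓘(ℝ, E) ∞ G] (H : Subgroup G)
    {φ : OpenPartialHomeomorph G E} (hφ : φ ∈ IsManifold.maximalAtlas 𝓘(ℝ, E) ∞ G)
    (h1 : (1 : G) ∈ φ.source) {F : Submodule ℝ E} (p : E →L[ℝ] F) (hp : ∀ x : F, p x = x)
    (hH : ∀ g ∈ φ.source, (g ∈ H ↔ φ g ∈ F)) :
    ∃ c : OpenPartialHomeomorph (G ⧸ H) (LinearMap.ker p.toLinearMap),
      ((1 : G) : G ⧸ H) ∈ c.source ∧ IsQuotientChart (E := E) H c := by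
  have : IsTopologicalGroup G := topologicalGroup_of_lieGroup 𝓘(ℝ, E) ∞
  set B : E →L[ℝ] E := F.subtypeL ∘L p with hB
  set A : E →L[ℝ] E := ContinuousLinearMap.id ℝ E - B with hA
  have hAB : ∀ x, A x + B x = x := fun x => by simp [hA]
  set M := LinearMap.ker p.toLinearMap with hM
  have hAM : ∀ x, A x ∈ M := fun x => by
    simp only [hM, LinearMap.mem_ker, hA, hB]
    simp [hp]
  set Q : E →L[ℝ] M := A.codRestrict M hAM with hQ
  have hpM : ∀ m : M, p (m : E) = 0 := fun m => m.2
  have hBM : ∀ m : M, B (m : E) = 0 := fun m => by simp [hB, hpM]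
  have hAMm : ∀ m : M, A (m : E) = m := fun m => by simp [hA, hBM]
  have hBF : ∀ f : F, B (f : E) = f := fun f => by simp [hB, hp]
  have hAF : ∀ f : F, A (f : E) = 0 := fun f => by simp [hA, hBF]
  obtain ⟨N, U, r, hNo, h0N, hUo, hNt, hNU, hUN, hr⟩ := exists_slice hφ h1 A B hAB
  have hs := contMDiffOn_symm_of_mem_maximalAtlas hφ
  have ht : φ 1 ∈ φ.target := φ.map_source h1
  have h1F : φ 1 ∈ F := (hH 1 h1).1 H.one_mem
  set σ : M → G := fun m => φ.symm (φ 1 + m) with hσ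
  have hσ0 : σ 0 = 1 := by simp [hσ, φ.left_inv h1]
  -- the radius in the direction of the subgroup
  obtain ⟨ε, hε, hεN⟩ : ∃ ε > 0, ∀ m : M, ∀ f : F, ‖m‖ < ε → ‖f‖ < ε → (m + f : E) ∈ N := by
    have hc : ContinuousAt (fun q : M × F => (q.1 + q.2 : E)) 0 := by fun_prop
    have := hc.preimage_mem_nhds (hNo.mem_nhds (by simpa using h0N))
    obtain ⟨ε, hε, hb⟩ := Metric.mem_nhds_iff.1 this
    refine ⟨ε, hε, fun m f hm hf => ?_⟩
    have h2 : ((m, f) : M × F) ∈ Metric.ball (0 : M × F) ε := by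
      rw [mem_ball_zero_iff, Prod.norm_def]
      exact max_lt hm hf
    exact hb h2
  -- the radius in the transversal direction
  obtain ⟨δ, hδ, hδε, hδ'⟩ : ∃ δ > 0, δ ≤ ε ∧ ∀ m m' : M, ‖m‖ < δ → ‖m'‖ < δ →
      (σ m')⁻¹ * σ m ∈ φ.source ∧ ‖φ ((σ m')⁻¹ * σ m) - φ 1‖ < ε := by
    have hσc : ContinuousAt σ 0 := by
      have : ContinuousAt φ.symm (φ 1 + ((0 : M) : E)) := by
        simpa using φ.symm.continuousAt ht
      exact this.comp (f := fun m : M => φ 1 + (m : E)) (by fun_prop)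
    have hk : ContinuousAt (fun q : M × M => (σ q.2)⁻¹ * σ q.1) 0 := by
      refine ContinuousAt.mul (ContinuousAt.inv ?_) ?_
      · exact ContinuousAt.comp (f := Prod.snd) (g := σ) hσc continuousAt_snd
      · exact ContinuousAt.comp (f := Prod.fst) (g := σ) hσc continuousAt_fst
    have hset : φ.source ∩ φ ⁻¹' (Metric.ball (φ 1) ε) ∈ 𝓝 ((σ (0 : M × M).2)⁻¹ * σ (0 : M × M).1) := by
      refine (φ.isOpen_inter_preimage Metric.isOpen_ball).mem_nhds ?_
      simp [hσ0, h1, hε]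
    obtain ⟨δ, hδ, hb⟩ := Metric.mem_nhds_iff.1 (hk.preimage_mem_nhds hset)
    refine ⟨min δ ε, lt_min hδ hε, min_le_right _ _, fun m m' hm hm' => ?_⟩
    have : (m, m') ∈ Metric.ball (0 : M × M) δ := by
      rw [mem_ball_zero_iff, Prod.norm_def]
      exact max_lt (hm.trans_le (min_le_left _ _)) (hm'.trans_le (min_le_left _ _))
    have h2 := hb this
    refine ⟨h2.1, ?_⟩
    have h3 := h2.2
    simpa [dist_eq_norm] using h3
  set V : Set M := Metric.ball 0 δ with hV
  have hVN : ∀ m ∈ V, (m : E) ∈ N := fun m hm => by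
    have := hεN m 0 ((mem_ball_zero_iff.1 hm).trans_le hδε) (by simpa using hε)
    simpa using this
  have hσΨ : ∀ m : M, φ.symm (φ 1 + A m) * φ.symm (φ 1 + B m) = σ m := fun m => by
    simp [hAMm, hBM, hσ, φ.left_inv h1]
  have hinj : ∀ m ∈ V, ∀ m' ∈ V, (σ m : G ⧸ H) = σ m' → m = m' := by
    intro m hm m' hm' hmm
    obtain ⟨hks, hkn⟩ := hδ' m m' (mem_ball_zero_iff.1 hm) (mem_ball_zero_iff.1 hm')
    set k := (σ m')⁻¹ * σ m with hk
    have hkH : k ∈ H := QuotientGroup.eq.1 hmm.symm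
    have hkF : φ k - φ 1 ∈ F := F.sub_mem ((hH k hks).1 hkH) h1F
    have hx : ((m' : E) + (φ k - φ 1)) ∈ N :=
      hεN m' ⟨_, hkF⟩ ((mem_ball_zero_iff.1 hm').trans_le hδε) hkn
    have e1 : A ((m' : E) + (φ k - φ 1)) = m' := by
      rw [map_add, hAMm]; simpa using hAF ⟨_, hkF⟩
    have e2 : B ((m' : E) + (φ k - φ 1)) = φ k - φ 1 := by
      rw [map_add, hBM]; simpa using hBF ⟨_, hkF⟩
    have h3 := (hNU _ hx).2
    rw [e1, e2, add_sub_cancel, φ.left_inv hks] at h3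
    change r (σ m' * k) = _ at h3
    have h4 := (hNU _ (hVN m hm)).2
    rw [hσΨ] at h4
    have h5 : σ m' * k = σ m := by rw [hk]; group
    rw [h5, h4] at h3
    have := congrArg A h3
    rw [e1, hAMm] at this
    exact Subtype.ext this
  set U' : Set G := U ∩ r ⁻¹' {x | ‖Q x‖ < δ ∧ ‖p x‖ < ε} with hU'
  have hU'o : IsOpen U' := hr.continuousOn.isOpen_inter_preimage hUo
    ((isOpen_lt (f := fun x => ‖Q x‖) (by fun_prop) continuous_const).inter
      (isOpen_lt (f := fun x => ‖p x‖) (by fun_prop) continuous_const))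
  have hσU' : ∀ m ∈ V, σ m ∈ U' := fun m hm => by
    have h2 := hNU _ (hVN m hm)
    rw [hσΨ] at h2
    refine ⟨h2.1, ?_⟩
    rw [Set.mem_preimage, h2.2]
    refine ⟨?_, by simpa [hpM] using hε⟩
    have : Q (m : E) = m := Subtype.ext (hAMm m)
    rw [this]; exact mem_ball_zero_iff.1 hm
  have hU'σ : ∀ g ∈ U', Q (r g) ∈ V ∧ (σ (Q (r g)) : G ⧸ H) = g := by
    intro g hg
    refine ⟨mem_ball_zero_iff.2 hg.2.1, ?_⟩
    obtain ⟨hrN, hrg⟩ := hUN g hg.1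
    have hb := (hNt _ hrN).2
    rw [QuotientGroup.eq]
    have e1 : σ (Q (r g)) = φ.symm (φ 1 + A (r g)) := rfl
    have e2 : (σ (Q (r g)))⁻¹ * g = φ.symm (φ 1 + B (r g)) := by
      rw [e1]; nth_rewrite 2 [← hrg]; group
    rw [e2, hH _ (φ.map_target hb), φ.right_inv hb]
    exact F.add_mem h1F (p (r g)).2
  classical
  set q : G ⧸ H → M := fun s => if h : ∃ m ∈ V, (σ m : G ⧸ H) = s then h.choose else 0 with hq
  have hqσ : ∀ m ∈ V, q (σ m) = m := fun m hm => by
    have h : ∃ m' ∈ V, (σ m' : G ⧸ H) = σ m := ⟨m, hm, rfl⟩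
    simp only [hq, dif_pos h]
    exact hinj _ h.choose_spec.1 _ hm h.choose_spec.2
  have hqg : ∀ g ∈ U', q g = Q (r g) := fun g hg => by
    rw [← (hU'σ g hg).2, hqσ _ (hU'σ g hg).1]
  have hso : IsOpen ((fun g : G => (g : G ⧸ H)) '' U') :=
    QuotientGroup.isOpenMap_coe U' hU'o
  have hqs : ContMDiffOn 𝓘(ℝ, E) 𝓘(ℝ, M) ∞ (fun g : G => q (g : G ⧸ H))
      ((fun g : G => (g : G ⧸ H)) ⁻¹' ((fun g : G => (g : G ⧸ H)) '' U')) := by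
    rintro g ⟨g', hg', hgg⟩
    have hh : g⁻¹ * g' ∈ H := QuotientGroup.eq.1 hgg.symm
    set h := g⁻¹ * g' with hh'
    have hgh : g * h ∈ U' := by rw [hh']; simpa using hg'
    have hm : ContMDiffAt 𝓘(ℝ, E) 𝓘(ℝ, E) ∞ (fun x : G => x * h) g :=
      (contMDiff_mul_right (a := h)).contMDiffAt
    have h2 : ContMDiffAt 𝓘(ℝ, E) 𝓘(ℝ, M) ∞ (fun x : G => Q (r (x * h))) g := by
      have h3 : ContMDiffAt 𝓘(ℝ, E) 𝓘(ℝ, E) ∞ r (g * h) :=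
        hr.contMDiffAt (hUo.mem_nhds hgh.1)
      have h4 : ContMDiffAt 𝓘(ℝ, E) 𝓘(ℝ, E) ∞ (fun x : G => r (x * h)) g := h3.comp g hm
      exact Q.contDiff.contMDiff.contMDiffAt.comp g h4
    refine (h2.congr_of_eventuallyEq ?_).contMDiffWithinAt
    have : ∀ᶠ x in 𝓝 g, x * h ∈ U' :=
      (continuous_mul_const h).continuousAt.eventually (hU'o.mem_nhds hgh)
    filter_upwards [this] with x hx
    have e : (x : G ⧸ H) = ((x * h : G) : G ⧸ H) := by
      rw [QuotientGroup.eq]; simpa using hh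
    rw [e, hqg _ hx]
  have hσs : ContMDiffOn 𝓘(ℝ, M) 𝓘(ℝ, E) ∞ σ V := by
    refine hs.comp ?_ ?_
    · exact (contDiff_const.add M.subtypeL.contDiff).contMDiff.contMDiffOn
    · intro m hm
      have := (hNt _ (hVN m hm)).1
      rwa [hAMm] at this
  refine ⟨{ toFun := q
            invFun := fun m => (σ m : G ⧸ H)
            source := (fun g : G => (g : G ⧸ H)) '' U'
            target := V
            map_source' := ?_
            map_target' := fun m hm => ⟨σ m, hσU' m hm, rfl⟩
            left_inv' := ?_
            right_inv' := hqσ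
            open_source := hso
            open_target := Metric.isOpen_ball
            continuousOn_toFun := ?_
            continuousOn_invFun := ?_ }, ?_, ⟨hqs, σ, hσs, fun _ _ => rfl⟩⟩
  · rintro _ ⟨g, hg, rfl⟩
    change q g ∈ V
    rw [hqg g hg]; exact (hU'σ g hg).1
  · rintro _ ⟨g, hg, rfl⟩
    change (σ (q g) : G ⧸ H) = g
    rw [hqg g hg]; exact (hU'σ g hg).2
  · exact ((QuotientGroup.isQuotientMap_mk H).continuousOn_isOpen_iff hso).2 hqs.continuousOn
  · exact QuotientGroup.continuous_mk.comp_continuousOn hσs.continuousOn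
  · refine ⟨σ 0, hσU' 0 (by simpa [hV] using hδ), ?_⟩
    rw [hσ0]

theorem exists_quotientChart [CompleteSpace E] [LieGroup 𝓘(ℝ, E) ∞ G] (H : Subgroup G)
    [hH : IsBanachLieSubgroup E H] (s : G ⧸ H) :
    ∃ c : OpenPartialHomeomorph (G ⧸ H) (quotientModel E H),
      s ∈ c.source ∧ IsQuotientChart (E := E) H c := by
  have : IsTopologicalGroup G := topologicalGroup_of_lieGroup 𝓘(ℝ, E) ∞
  have h := (hH.exists_chart 1 H.one_mem).choose_spec
  obtain ⟨c, h1c, hc⟩ := exists_quotientChart_one H h.1 h.2.choose_spec.2.1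
    _ h.2.choose_spec.1.choose_spec h.2.choose_spec.2.2
  obtain ⟨u, rfl⟩ := QuotientGroup.mk_surjective s
  have h1c' : u⁻¹ • (u : G ⧸ H) ∈ c.source := by
    change ((u⁻¹ * u : G) : G ⧸ H) ∈ c.source
    rwa [inv_mul_cancel]
  refine ⟨(Homeomorph.smul u⁻¹).transOpenPartialHomeomorph c, h1c', ?_, ?_⟩
  · have : ContMDiffOn 𝓘(ℝ, E) 𝓘(ℝ, E) ∞ (fun g : G => u⁻¹ * g) Set.univ :=
      (contMDiff_mul_left (a := u⁻¹)).contMDiffOn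
    exact (hc.smooth_comp_mk.comp (this.mono (Set.subset_univ _)) fun g hg => hg)
  · obtain ⟨σ, hσ, hσ'⟩ := hc.exists_section
    refine ⟨fun x => u * σ x, ?_, fun x hx => ?_⟩
    · exact (contMDiff_mul_left (I := 𝓘(ℝ, E)) (n := ∞) (a := u)).comp_contMDiffOn hσ
    · change u • (σ x : G ⧸ H) = u⁻¹⁻¹ • c.symm x
      rw [inv_inv, hσ' x hx]

/-- The canonical smooth manifold structure of `G ⧸ H`. -/
instance [CompleteSpace E] [LieGroup 𝓘(ℝ, E) ∞ G] (H : Subgroup G) [IsBanachLieSubgroup E H] :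
    ChartedSpace (quotientModel E H) (G ⧸ H) where
  atlas := {c | IsQuotientChart (E := E) H c}
  chartAt s := (exists_quotientChart H s).choose
  mem_chart_source s := (exists_quotientChart H s).choose_spec.1
  chart_mem_atlas s := (exists_quotientChart H s).choose_spec.2

instance [CompleteSpace E] [LieGroup 𝓘(ℝ, E) ∞ G] (H : Subgroup G) [IsBanachLieSubgroup E H] :
    IsManifold 𝓘(ℝ, quotientModel E H) ∞ (G ⧸ H) := by
  refine isManifold_of_contDiffOn _ _ _ fun c c' hc hc' => ?_
  obtain ⟨σ, hσ, hσ'⟩ := hc.exists_section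
  rw [← contMDiffOn_iff_contDiffOn]
  refine ((hc'.smooth_comp_mk.comp (hσ.mono (t := (c.symm ≫ₕ c').source) ?_) ?_).congr ?_).mono ?_
  · intro x hx; exact (by simpa using hx : _ ∧ _).1
  · intro x hx
    have hx' : x ∈ c.target ∧ c.symm x ∈ c'.source := by simpa using hx
    change (σ x : G ⧸ H) ∈ c'.source
    rw [hσ' x hx'.1]; exact hx'.2
  · intro x hx
    have hx' : x ∈ c.target ∧ c.symm x ∈ c'.source := by simpa using hx
    change _ = c' (σ x : G ⧸ H)
    rw [hσ' x hx'.1]; rfl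
  · intro x hx; simpa using hx

end Quotient

/-! ### Homogeneous vector bundles -/

section Homogeneous

/-- A uniformly continuous unitary representation of `G` on the Hilbert space `V`: a group
homomorphism into the unitary operators that is continuous for the operator norm. -/
abbrev UnitaryRep (G : Type*) [Group G] [TopologicalSpace G] (V : Type*) [NormedAddCommGroup V]
    [InnerProductSpace ℂ V] [CompleteSpace V] : Type _ :=
  G →ₜ* unitary (V →L[ℂ] V)

variable {E : Type*} [NormedAddCommGroup E] [NormedSpace ℝ E]
  {G : Type*} [Group G] [TopologicalSpace G] [ChartedSpace E G] {H : Subgroup G}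
  {V : Type*} [NormedAddCommGroup V] [InnerProductSpace ℂ V] [CompleteSpace V]

theorem unitary_inner {V : Type*} [NormedAddCommGroup V] [InnerProductSpace ℂ V] [CompleteSpace V]
    (u : unitary (V →L[ℂ] V)) (f h : V) :
    inner ℂ ((u : V →L[ℂ] V) f) ((u : V →L[ℂ] V) h) = inner ℂ f h := by
  rw [← ContinuousLinearMap.adjoint_inner_right, ← ContinuousLinearMap.comp_apply]
  have : (ContinuousLinearMap.adjoint (u : V →L[ℂ] V)) ∘L (u : V →L[ℂ] V) = 1 :=
    (Unitary.mem_iff.1 u.2).1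
  rw [this]; rfl

namespace UnitaryRep

variable (ρ : UnitaryRep H V)

theorem mul_apply (w w' : H) (f : V) :
    (ρ (w * w') : V →L[ℂ] V) f = (ρ w : V →L[ℂ] V) ((ρ w' : V →L[ℂ] V) f) := by
  rw [map_mul]; rfl

@[simp] theorem one_apply (f : V) : (ρ 1 : V →L[ℂ] V) f = f := by
  rw [map_one]; rfl

/-- The equivalence relation on `G × V` given by `(g, f) ∼ (g w, ρ(w⁻¹) f)` for `w ∈ H`. -/
def setoid : Setoid (G × V) where
  r p q := ∃ w : H, q.1 = p.1 * w ∧ q.2 = (ρ w⁻¹ : V →L[ℂ] V) p.2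
  iseqv :=
    { refl := fun p => ⟨1, by simp, by simp⟩
      symm := by
        rintro p q ⟨w, h1, h2⟩
        exact ⟨w⁻¹, by simp [h1], by rw [h2, ← mul_apply]; simp⟩
      trans := by
        rintro p q r ⟨w, h1, h2⟩ ⟨w', h3, h4⟩
        exact ⟨w * w', by simp [h3, h1, mul_assoc], by rw [h4, h2, ← mul_apply]; simp⟩ }

/-- The total space `G ×_H V` of the homogeneous bundle induced by `ρ`, with the quotient
topology. -/
def AssocSpace : Type _ := Quotient ρ.setoid

instance : TopologicalSpace ρ.AssocSpace :=
  inferInstanceAs (TopologicalSpace (Quotient ρ.setoid))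

/-- The class `[(u, f)]` in `G ×_H V`. -/
def mk (u : G) (f : V) : ρ.AssocSpace := Quotient.mk ρ.setoid (u, f)

/-- The bundle projection `G ×_H V → G ⧸ H`, `[(u, f)] ↦ u H`. -/
def proj : ρ.AssocSpace → G ⧸ H :=
  Quotient.lift (fun p : G × V => (p.1 : G ⧸ H)) (by
    rintro p q ⟨w, h1, -⟩
    rw [QuotientGroup.eq, h1]; simp)

@[simp] theorem proj_mk (u : G) (f : V) : ρ.proj (ρ.mk u f) = (u : G ⧸ H) := rfl

theorem mk_mul (u : G) (w : H) (f : V) : ρ.mk (u * w) f = ρ.mk u ((ρ w : V →L[ℂ] V) f) := by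
  refine (Quotient.sound (s := ρ.setoid) ⟨w, rfl, ?_⟩).symm
  rw [← mul_apply]; simp

/-- The fiber of `G ×_H V` over `s ∈ G ⧸ H`. -/
def Fiber (s : G ⧸ H) : Type _ := {x : ρ.AssocSpace // ρ.proj x = s}

open Classical in
/-- The extension of `ρ` by `0` from `H` to all of `G`. -/
def zeroExt (g : G) : V →L[ℂ] V := if h : g ∈ H then (ρ ⟨g, h⟩ : V →L[ℂ] V) else 0

theorem zeroExt_of_mem {g : G} (h : g ∈ H) : ρ.zeroExt g = (ρ ⟨g, h⟩ : V →L[ℂ] V) := dif_pos h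

theorem continuousOn_zeroExt : ContinuousOn ρ.zeroExt (H : Set G) := by
  rw [continuousOn_iff_continuous_domRestrict]
  have : (H : Set G).domRestrict ρ.zeroExt = fun w : H => (ρ w : V →L[ℂ] V) := by
    funext w; exact ρ.zeroExt_of_mem w.2
  rw [this]
  exact continuous_subtype_val.comp ρ.continuous_toFun

/-- The coordinate of an element of `G ×_H V` with respect to `u ∈ G`: the vector `f` such that the
element equals `[(u, f)]`, if there is one. -/
def coord (u : G) : ρ.AssocSpace → V :=
  Quotient.lift (fun p : G × V => ρ.zeroExt (u⁻¹ * p.1) p.2) (by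
    rintro p q ⟨w, h1, h2⟩
    rw [h1, h2]
    by_cases h : u⁻¹ * p.1 ∈ H
    · have h' : u⁻¹ * (p.1 * w) ∈ H := by rw [← mul_assoc]; exact H.mul_mem h w.2
      rw [ρ.zeroExt_of_mem h, ρ.zeroExt_of_mem h', ← mul_apply]
      congr 3
      apply Subtype.ext; simp [mul_assoc]
    · have h' : u⁻¹ * (p.1 * w) ∉ H := by
        rw [← mul_assoc]; exact fun hh => h ((H.mul_mem_cancel_right w.2).1 hh)
      simp [zeroExt, h, h'])

theorem coord_mk (u v : G) (f : V) : ρ.coord u (ρ.mk v f) = ρ.zeroExt (u⁻¹ * v) f := rfl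

@[simp] theorem coord_mk_self (u : G) (f : V) : ρ.coord u (ρ.mk u f) = f := by
  rw [coord_mk, inv_mul_cancel, ρ.zeroExt_of_mem H.one_mem]
  exact ρ.one_apply f

theorem mk_coord (u : G) (x : ρ.AssocSpace) (hx : ρ.proj x = u) : ρ.mk u (ρ.coord u x) = x := by
  induction x using Quotient.inductionOn with
  | h p =>
    obtain ⟨v, f⟩ := p
    have h : u⁻¹ * v ∈ H := QuotientGroup.eq.1 hx.symm
    change ρ.mk u (ρ.zeroExt (u⁻¹ * v) f) = ρ.mk v f
    rw [ρ.zeroExt_of_mem h, ← mk_mul]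
    simp

/-- For `u ∈ s`, the bijection `f ↦ [(u, f)]` from `V` onto the fiber over `s`. -/
def fiberEquiv (u : G) {s : G ⧸ H} (hu : (u : G ⧸ H) = s) : V ≃ ρ.Fiber s where
  toFun f := ⟨ρ.mk u f, hu⟩
  invFun x := ρ.coord u x.1
  left_inv f := ρ.coord_mk_self u f
  right_inv x := Subtype.ext (ρ.mk_coord u x.1 (x.2.trans hu.symm))

/-- The representative of the coset `s` used to transport the Hilbert space structure of `V` to the
fiber over `s`; the structure does not depend on it, see `fiberIso`. -/
def refEquiv (s : G ⧸ H) : ρ.Fiber s ≃ V :=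
  (ρ.fiberEquiv (Quotient.out s) (Quotient.out_eq' s)).symm

instance (s : G ⧸ H) : AddCommGroup (ρ.Fiber s) := (ρ.refEquiv s).addCommGroup

instance (s : G ⧸ H) : Module ℂ (ρ.Fiber s) := (ρ.refEquiv s).module ℂ

/-- `refEquiv` as a linear isomorphism. -/
def refLinearEquiv (s : G ⧸ H) : ρ.Fiber s ≃ₗ[ℂ] V := (ρ.refEquiv s).linearEquiv ℂ

instance (s : G ⧸ H) : NormedAddCommGroup (ρ.Fiber s) :=
  NormedAddCommGroup.induced (ρ.Fiber s) V (ρ.refLinearEquiv s) (ρ.refLinearEquiv s).injective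

/-- The Hermitian structure of `G ×_H V`: `([(u, f)], [(u, h)])_s = (f ∣ h)`, see `inner_mk`. -/
instance (s : G ⧸ H) : InnerProductSpace ℂ (ρ.Fiber s) where
  norm_smul_le c x := by
    change ‖ρ.refLinearEquiv s (c • x)‖ ≤ ‖c‖ * ‖ρ.refLinearEquiv s x‖
    rw [map_smul]; exact norm_smul_le _ _
  inner x y := inner ℂ (ρ.refLinearEquiv s x) (ρ.refLinearEquiv s y)
  norm_sq_eq_re_inner x := norm_sq_eq_re_inner (ρ.refLinearEquiv s x)
  conj_inner_symm x y := inner_conj_symm _ _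
  add_left x y z := by rw [map_add, inner_add_left]
  smul_left x y r := by rw [map_smul, inner_smul_left]

theorem refLinearEquiv_apply (u : G) {s : G ⧸ H} (hu : (u : G ⧸ H) = s) :
    ∃ w : H, ∀ f, ρ.refLinearEquiv s (ρ.fiberEquiv u hu f) = (ρ w : V →L[ℂ] V) f := by
  have h : (Quotient.out s)⁻¹ * u ∈ H :=
    QuotientGroup.eq.1 ((QuotientGroup.out_eq' s).trans hu.symm)
  refine ⟨⟨_, h⟩, fun f => ?_⟩
  change ρ.coord (Quotient.out s) (ρ.mk u f) = _
  rw [coord_mk, ρ.zeroExt_of_mem h]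

theorem inner_mk (u : G) {s : G ⧸ H} (hu : (u : G ⧸ H) = s) (f h : V) :
    inner ℂ (ρ.fiberEquiv u hu f) (ρ.fiberEquiv u hu h) = inner ℂ f h := by
  obtain ⟨w, hw⟩ := ρ.refLinearEquiv_apply u hu
  change inner ℂ (ρ.refLinearEquiv s _) (ρ.refLinearEquiv s _) = _
  rw [hw, hw, unitary_inner]

/-- For every `u ∈ s`, the map `f ↦ [(u, f)]` is a linear isometry of `V` onto the fiber over
`s`. -/
def fiberIso (u : G) {s : G ⧸ H} (hu : (u : G ⧸ H) = s) : V ≃ₗᵢ[ℂ] ρ.Fiber s :=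
  LinearIsometryEquiv.mk
    { ρ.fiberEquiv u hu with
      map_add' := fun f h => by
        obtain ⟨w, hw⟩ := ρ.refLinearEquiv_apply u hu
        apply (ρ.refLinearEquiv s).injective
        change ρ.refLinearEquiv s (ρ.fiberEquiv u hu _) =
          ρ.refLinearEquiv s (ρ.fiberEquiv u hu _ + ρ.fiberEquiv u hu _)
        rw [map_add (ρ.refLinearEquiv s), hw, hw, hw, map_add]
      map_smul' := fun c f => by
        obtain ⟨w, hw⟩ := ρ.refLinearEquiv_apply u hu
        apply (ρ.refLinearEquiv s).injective
        change ρ.refLinearEquiv s (ρ.fiberEquiv u hu _) =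
          ρ.refLinearEquiv s (c • ρ.fiberEquiv u hu _)
        rw [map_smul (ρ.refLinearEquiv s), hw, hw, map_smul] }
    (fun f => by
      have := ρ.inner_mk u hu f f
      rw [inner_self_eq_norm_sq_to_K, inner_self_eq_norm_sq_to_K] at this
      have h2 : ‖ρ.fiberEquiv u hu f‖ ^ 2 = ‖f‖ ^ 2 := by exact_mod_cast this
      exact (sq_eq_sq₀ (norm_nonneg _) (norm_nonneg _)).1 h2)

@[simp] theorem coe_fiberIso (u : G) {s : G ⧸ H} (hu : (u : G ⧸ H) = s) (f : V) :
    (ρ.fiberIso u hu f).1 = ρ.mk u f := rfl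

/-- The total space of the bundle, as a disjoint union of fibers, carries the topology of
`G ×_H V`. -/
instance : TopologicalSpace (TotalSpace V ρ.Fiber) :=
  TopologicalSpace.induced (fun x => x.2.1) inferInstance

/-- `[(u, f)]` as a point of the disjoint union of the fibers. -/
def totalMk (p : G × V) : TotalSpace V ρ.Fiber :=
  ⟨(p.1 : G ⧸ H), ⟨ρ.mk p.1 p.2, rfl⟩⟩

theorem totalMk_surjective : Function.Surjective ρ.totalMk := by
  rintro ⟨s, x, hx⟩
  induction x using Quotient.inductionOn with
  | h p => subst hx; exact ⟨p, rfl⟩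

theorem val_injective : Function.Injective (fun x : TotalSpace V ρ.Fiber => x.2.1) := by
  rintro ⟨s, x, hx⟩ ⟨s', x', hx'⟩ h
  dsimp only at h
  subst h hx hx'
  rfl

/-- The topology of the total space is the quotient topology of `G × V`. -/
theorem isQuotientMap_totalMk : Topology.IsQuotientMap ρ.totalMk := by
  have hbij : Function.Bijective (fun x : TotalSpace V ρ.Fiber => x.2.1) := by
    refine ⟨ρ.val_injective, fun x => ⟨⟨ρ.proj x, x, rfl⟩, rfl⟩⟩
  have hhomeo : IsHomeomorph (fun x : TotalSpace V ρ.Fiber => x.2.1) :=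
    (isHomeomorph_iff_isEmbedding_surjective).2 ⟨⟨⟨rfl⟩, hbij.1⟩, hbij.2⟩
  have hq : Topology.IsQuotientMap (fun p : G × V => ρ.mk p.1 p.2) :=
    isQuotientMap_quotient_mk'
  have : ρ.totalMk = (hhomeo.homeomorph _).symm ∘ (fun p : G × V => ρ.mk p.1 p.2) := by
    funext p
    apply (hhomeo.homeomorph _).injective
    exact ((hhomeo.homeomorph _).apply_symm_apply _).symm
  rw [this]
  exact (hhomeo.homeomorph _).symm.isQuotientMap.comp hq

theorem continuous_totalMk : Continuous ρ.totalMk := ρ.isQuotientMap_totalMk.continuous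

theorem continuous_proj : Continuous (TotalSpace.proj : TotalSpace V ρ.Fiber → G ⧸ H) :=
  ρ.isQuotientMap_totalMk.continuous_iff.2
    (QuotientGroup.continuous_mk.comp continuous_fst)

end UnitaryRep

variable [CompleteSpace E] [LieGroup 𝓘(ℝ, E) ∞ G] [IsBanachLieSubgroup E H]

variable (E H) in
/-- A smooth section of `G → G ⧸ H` over an open set. -/
structure LocalSection where
  /-- The domain of the section. -/
  dom : Set (G ⧸ H)
  isOpen_dom : IsOpen dom
  /-- The section. -/
  toFun : G ⧸ H → G
  smooth : ContMDiffOn 𝓘(ℝ, quotientModel E H) 𝓘(ℝ, E) ∞ toFun dom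
  mk_toFun : ∀ s ∈ dom, (toFun s : G ⧸ H) = s

theorem LocalSection.exists_mem (s : G ⧸ H) : ∃ σ : LocalSection E H, s ∈ σ.dom := by
  have hc : IsQuotientChart (E := E) H (chartAt (quotientModel E H) s) :=
    chart_mem_atlas (quotientModel E H) s
  obtain ⟨σ, hσ, hσ'⟩ := hc.exists_section
  refine ⟨⟨(chartAt (quotientModel E H) s).source, (chartAt (quotientModel E H) s).open_source,
    fun t => σ (chartAt (quotientModel E H) s t), ?_, fun t ht => ?_⟩, mem_chart_source _ s⟩
  · exact hσ.comp contMDiffOn_chart fun t ht => (chartAt (quotientModel E H) s).map_source ht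
  · rw [hσ' _ ((chartAt (quotientModel E H) s).map_source ht),
      (chartAt (quotientModel E H) s).left_inv ht]

namespace UnitaryRep

variable (ρ : UnitaryRep H V)

open Classical in
/-- The local trivialization `(s, f) ↦ [(σ(s), f)]` of `G ×_H V` defined by a smooth local section
`σ` of `G → G ⧸ H`. -/
def trivialization (σ : LocalSection E H) : Trivialization V (π V ρ.Fiber) where
  toFun x := (x.1, ρ.coord (σ.toFun x.1) x.2.1)
  invFun q := if h : (σ.toFun q.1 : G ⧸ H) = q.1 then ⟨q.1, ρ.fiberEquiv _ h q.2⟩ else ⟨q.1, 0⟩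
  source := TotalSpace.proj ⁻¹' σ.dom
  target := σ.dom ×ˢ Set.univ
  map_source' x hx := ⟨hx, trivial⟩
  map_target' q hq := by
    rw [dif_pos (σ.mk_toFun _ hq.1)]; exact hq.1
  left_inv' x hx := by
    rw [dif_pos (σ.mk_toFun _ hx)]
    exact congrArg (TotalSpace.mk x.1) ((ρ.fiberEquiv _ (σ.mk_toFun _ hx)).apply_symm_apply x.2)
  right_inv' q hq := by
    rw [dif_pos (σ.mk_toFun _ hq.1)]
    exact Prod.ext rfl ((ρ.fiberEquiv _ (σ.mk_toFun _ hq.1)).symm_apply_apply q.2)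
  open_source := σ.isOpen_dom.preimage ρ.continuous_proj
  open_target := σ.isOpen_dom.prod isOpen_univ
  continuousOn_toFun := by
    have : IsTopologicalGroup G := topologicalGroup_of_lieGroup 𝓘(ℝ, E) ∞
    rw [ρ.isQuotientMap_totalMk.continuousOn_isOpen_iff (σ.isOpen_dom.preimage ρ.continuous_proj)]
    refine (ρ.continuous_proj.comp ρ.continuous_totalMk).continuousOn.prodMk ?_
    change ContinuousOn (fun p : G × V => ρ.zeroExt ((σ.toFun (p.1 : G ⧸ H))⁻¹ * p.1) p.2) _
    refine ContinuousOn.clm_apply ?_ continuousOn_snd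
    refine ρ.continuousOn_zeroExt.comp (ContinuousOn.mul (ContinuousOn.inv ?_) continuousOn_fst) ?_
    · exact σ.smooth.continuousOn.comp
        (QuotientGroup.continuous_mk.comp continuous_fst).continuousOn fun p hp => hp
    · intro p hp
      exact QuotientGroup.eq.1 (σ.mk_toFun _ hp)
  continuousOn_invFun := by
    have : ContinuousOn (fun q : (G ⧸ H) × V => ρ.totalMk (σ.toFun q.1, q.2))
        (σ.dom ×ˢ Set.univ) :=
      ρ.continuous_totalMk.comp_continuousOn
        ((σ.smooth.continuousOn.comp continuousOn_fst fun q hq => hq.1).prodMk continuousOn_snd)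
    refine this.congr fun q hq => ?_
    dsimp only
    rw [dif_pos (σ.mk_toFun _ hq.1)]
    exact ρ.val_injective rfl
  baseSet := σ.dom
  open_baseSet := σ.isOpen_dom
  source_eq := rfl
  target_eq := rfl
  proj_toFun x hx := rfl

theorem trivialization_apply (σ : LocalSection E H) {s : G ⧸ H} (x : ρ.Fiber s) :
    ρ.trivialization σ ⟨s, x⟩ = (s, ρ.coord (σ.toFun s) x.1) := rfl

theorem coord_eq (σ : LocalSection E H) {s : G ⧸ H} (hs : s ∈ σ.dom) (x : ρ.Fiber s) :
    ρ.coord (σ.toFun s) x.1 = (ρ.fiberIso _ (σ.mk_toFun s hs)).symm x := rfl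

variable (E) in
/-- `G ×_H V` is a fiber bundle; its atlas consists of the trivializations defined by the smooth
local sections of `G → G ⧸ H`. -/
@[reducible] def fiberBundle : FiberBundle V ρ.Fiber where
  totalSpaceMk_isInducing' s := by
    obtain ⟨σ, hσ⟩ := LocalSection.exists_mem (E := E) s
    rw [Topology.isInducing_iff_nhds]
    intro x
    have hx : (⟨s, x⟩ : TotalSpace V ρ.Fiber) ∈ (ρ.trivialization σ).source := hσ
    have hc : (fun y : ρ.Fiber s => ρ.trivialization σ ⟨s, y⟩) =
        fun y => (s, (ρ.fiberIso _ (σ.mk_toFun s hσ)).symm y) := rfl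
    have hi : Topology.IsInducing (fun y : ρ.Fiber s => ρ.trivialization σ ⟨s, y⟩) := by
      rw [hc]
      exact (Topology.isInducing_const_prod.2 (ρ.fiberIso _ (σ.mk_toFun s hσ)).symm.toHomeomorph.isInducing)
    rw [(ρ.trivialization σ).toOpenPartialHomeomorph.nhds_eq_comap_inf_principal hx,
      Filter.comap_inf, Filter.comap_comap, Filter.comap_principal]
    have : TotalSpace.mk s ⁻¹' (ρ.trivialization σ).source = Set.univ :=
      Set.eq_univ_of_forall fun y => hσ
    rw [this, Filter.principal_univ, inf_top_eq]
    exact hi.nhds_eq_comap x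
  trivializationAtlas' := Set.range fun σ : LocalSection E H => ρ.trivialization σ
  trivializationAt' s := ρ.trivialization (LocalSection.exists_mem (E := E) s).choose
  mem_baseSet_trivializationAt' s := (LocalSection.exists_mem (E := E) s).choose_spec
  trivialization_mem_atlas' s := ⟨_, rfl⟩

instance (σ : LocalSection E H) : (ρ.trivialization σ).IsLinear ℂ where
  linear s hs := ((ρ.fiberIso _ (σ.mk_toFun s hs)).symm.toLinearEquiv.toLinearMap).isLinear

variable (E) in
theorem vectorBundle :
    letI := ρ.fiberBundle E
    VectorBundle ℂ V ρ.Fiber :=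
  letI := ρ.fiberBundle E
  { trivialization_linear' := by
      rintro _ ⟨σ, rfl⟩
      infer_instance
    continuousOn_coordChange' := by
      have : IsTopologicalGroup G := topologicalGroup_of_lieGroup 𝓘(ℝ, E) ∞
      rintro _ _ ⟨σ, rfl⟩ ⟨σ', rfl⟩
      have : ContinuousOn (fun s => ρ.zeroExt ((σ'.toFun s)⁻¹ * σ.toFun s)) (σ.dom ∩ σ'.dom) := by
        refine ρ.continuousOn_zeroExt.comp ((σ'.smooth.continuousOn.mono Set.inter_subset_right).inv.mul
          (σ.smooth.continuousOn.mono Set.inter_subset_left)) ?_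
        intro s hs
        exact QuotientGroup.eq.1 ((σ'.mk_toFun s hs.2).trans (σ.mk_toFun s hs.1).symm)
      refine this.congr fun s hs => ?_
      ext f
      change Trivialization.coordChangeL ℂ (ρ.trivialization σ) (ρ.trivialization σ') s f = _
      rw [Trivialization.coordChangeL_apply' _ _ hs]
      change (ρ.trivialization σ' ((ρ.trivialization σ).invFun (s, f))).2 = _
      have h2 : (ρ.trivialization σ).invFun (s, f) =
          ⟨s, ρ.fiberEquiv _ (σ.mk_toFun s hs.1) f⟩ := dif_pos (σ.mk_toFun s hs.1)
      rw [h2]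
      rfl }

end UnitaryRep

/-! ### The reproducing kernel on a homogeneous bundle -/

variable {HA : Type*} [NormedAddCommGroup HA] [InnerProductSpace ℂ HA] [CompleteSpace HA]
  {HB : Submodule ℂ HA} [CompleteSpace HB]

/-- The operator `P ρ_A(u⁻¹) ρ_A(v)|_{H_B}` on `H_B`, where `P` is the orthogonal projection of
`H_A` onto `H_B`. -/
def compression (ρA : UnitaryRep G HA) (HB : Submodule ℂ HA) [CompleteSpace HB] (u v : G) :
    HB →L[ℂ] HB :=
  HB.orthogonalProjectionOnto ∘L (ρA u⁻¹ : HA →L[ℂ] HA) ∘L (ρA v : HA →L[ℂ] HA) ∘L HB.subtypeL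

/-- The kernel `K_ρ` on `G_A ×_{G_B} H_B`, written with chosen representatives `u ∈ s` and `v ∈ t`
as `K_ρ(s, t) [(v, f)] = [(u, P ρ_A(u⁻¹) ρ_A(v) f)]`; see `homogeneousKernel_mk`. -/
def homogeneousKernel {H : Subgroup G} (ρA : UnitaryRep G HA) (ρB : UnitaryRep H HB) :
    BundleKernel ρB.Fiber := fun s t =>
  ((ρB.fiberIso _ (QuotientGroup.out_eq' s)).toContinuousLinearEquiv : HB →L[ℂ] ρB.Fiber s) ∘L
    compression ρA HB (Quotient.out s) (Quotient.out t) ∘L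
    ((ρB.fiberIso _ (QuotientGroup.out_eq' t)).symm.toContinuousLinearEquiv :
      ρB.Fiber t →L[ℂ] HB)

/-- The defining formula of `K_ρ`, for arbitrary representatives. -/
theorem homogeneousKernel_mk {H : Subgroup G} (ρA : UnitaryRep G HA) (ρB : UnitaryRep H HB)
    (hρ : ∀ (w : H) (f : HB), ((ρB w : HB →L[ℂ] HB) f : HA) = (ρA (w : G) : HA →L[ℂ] HA) f)
    (u v : G) (f : HB) :
    homogeneousKernel ρA ρB u v (ρB.fiberIso v rfl f) =
      ρB.fiberIso u rfl (compression ρA HB u v f) := by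
  have hA : ∀ (a b : G) (x : HA), (ρA a : HA →L[ℂ] HA) ((ρA b : HA →L[ℂ] HA) x) =
      (ρA (a * b) : HA →L[ℂ] HA) x := fun a b x => by rw [map_mul]; rfl
  have hA' : ∀ (a : G) (x y : HA), inner ℂ x ((ρA a⁻¹ : HA →L[ℂ] HA) y) =
      inner ℂ ((ρA a : HA →L[ℂ] HA) x) y := fun a x y => by
    rw [← unitary_inner (ρA a) x, hA, mul_inv_cancel, map_one]; rfl
  set u' := Quotient.out (u : G ⧸ H) with hu'
  set v' := Quotient.out (v : G ⧸ H) with hv'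
  have hu : u'⁻¹ * u ∈ H := QuotientGroup.eq.1 (QuotientGroup.out_eq' (u : G ⧸ H))
  have hv : v'⁻¹ * v ∈ H := QuotientGroup.eq.1 (QuotientGroup.out_eq' (v : G ⧸ H))
  have e1 : (ρB.fiberIso v' (QuotientGroup.out_eq' (v : G ⧸ H))).symm (ρB.fiberIso v rfl f) =
      (ρB ⟨_, hv⟩ : HB →L[ℂ] HB) f := by
    change ρB.coord v' (ρB.mk v f) = _
    rw [ρB.coord_mk, ρB.zeroExt_of_mem hv]
  have e2 : ∀ h : HB, ρB.fiberIso u rfl h = ρB.fiberIso u' (QuotientGroup.out_eq' (u : G ⧸ H))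
      ((ρB ⟨_, hu⟩ : HB →L[ℂ] HB) h) := fun h => by
    apply Subtype.ext
    change ρB.mk u h = ρB.mk u' _
    rw [← ρB.mk_mul]; simp
  rw [e2]
  change ρB.fiberIso u' _ (compression ρA HB u' v'
    ((ρB.fiberIso v' (QuotientGroup.out_eq' (v : G ⧸ H))).symm (ρB.fiberIso v rfl f))) = _
  rw [e1]
  congr 1
  refine ext_inner_left ℂ fun k => ?_
  obtain ⟨k', rfl⟩ : ∃ k', k = (ρB ⟨_, hu⟩ : HB →L[ℂ] HB) k' :=
    ⟨(ρB (⟨_, hu⟩⁻¹) : HB →L[ℂ] HB) k, by rw [← ρB.mul_apply]; simp⟩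
  rw [unitary_inner]
  have hP : ∀ (x : HB) (y : HA), inner ℂ x (HB.orthogonalProjectionOnto y) = inner ℂ (x : HA) y :=
    fun x y => by simp
  simp only [compression, ContinuousLinearMap.comp_apply, hP, hA', Submodule.subtypeL_apply, hρ]
  simp only [hA]
  simp
end Homogeneous

end

/-! The algebraic heart is that the kernel factors through the large representation: the vectors
$\rho_A(u)h$ and $\rho_A(v)f$ satisfy $(K(s,t)[(v,f)]\mid[(u,h)])=(\rho_A(v)f\mid\rho_A(u)h)$ for
$u\in s$, $v\in t$ (`inner_homogeneousKernel`). So $K$ is a Gram kernel, hence positive definite,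
and unitarity of $\rho_A(u)$ gives $K(s,s)=\mathrm{id}$. Since $\rho_A(G_A)\mathcal H_B$ spans a
dense subspace, $\rho_A(u)f\mapsto K_{[(u,f)]}$ extends to a unitary $W:\mathcal H_A\to\mathcal H^K$
(`exists_equiv_space`).

The analytic input is that a norm-continuous homomorphism $f$ from a Banach-Lie group to a Banach
algebra is smooth (`MonoidHom.contMDiff_of_continuous`). In a chart at the identity the group law is
$x+y+O(\|x\|\|y\|)$. Powers of $f(x)$ that stay close to $1$ force $\|f(x)-1\|=O(\|x\|)$; then $f-1$
is additive up to $O(\|x\|\|y\|)$, which yields a derivative at $0$. Multiplicativity transports the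
derivative to nearby points by a formula $f'(x)=f(x)\cdot(\text{smooth})$, and bootstrapping gives
all orders.

Given a smooth $\rho_A$, what remains is composition with smooth local sections $\sigma,\sigma'$ of
$G_A\to Z$. In trivializations both the kernel and the transition functions are compressions
$P\rho_A(\sigma^{-1})\rho_A(\sigma')|_{\mathcal H_B}$; smoothness of $\rho_B$ itself is never
needed. Finally $\zeta_K(s)=W\rho_A(\sigma(s))\mathcal H_B$ is locally the range of a smooth family
of isometries, which is smooth in the Grassmannian charts (`Gr.isSmoothMap_of_isometry`). -/

noncomputable section

/-! ### Differentiability of multiplicative maps on local groups -/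

section LocalGroup

variable {E : Type*} [NormedAddCommGroup E] [NormedSpace ℝ E]

/-- A map that is additive up to an error `O(‖x‖ ‖y‖)` and bounded by a multiple of the norm is
differentiable at the origin. -/
theorem exists_hasFDerivAt_zero_of_quasiadditive {A : Type*} [NormedAddCommGroup A]
    [NormedSpace ℝ A] [CompleteSpace A] {F : E → A} {C L δ : ℝ} (hδ : 0 < δ)
    (hadd : ∀ x y, ‖x‖ < δ → ‖y‖ < δ → ‖F (x + y) - F x - F y‖ ≤ C * ‖x‖ * ‖y‖)
    (hL : ∀ x, ‖x‖ < δ → ‖F x‖ ≤ L * ‖x‖) : ∃ F' : E →L[ℝ] A, HasFDerivAt F F' 0 := by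
  have hF0 : F 0 = 0 := by simpa using hL 0 (by simpa using hδ)
  -- The derivative is found by rescaling: its value at `v` will be the limit of these dyadic
  -- difference quotients.
  set a : ℕ → E → A := fun n v => (2 : ℝ) ^ n • F (((2 : ℝ) ^ n)⁻¹ • v) with ha
  have hpow : ∀ n : ℕ, (0 : ℝ) < 2 ^ n := fun n => by positivity
  -- Quasi-additivity at $w=2^{-n-1}v$ costs $2^n\cdot C\|v\|^2/4^{n+1}$. The bound is written as
  -- $c/2/2^n$ so that summing the geometric series from $n=0$ gives total error $c=\frac
  -- C2\|v\|^2$.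
  have hstep : ∀ v, ‖v‖ < δ → ∀ n, dist (a n v) (a (n + 1) v) ≤ (C / 2 * ‖v‖ ^ 2) / 2 / 2 ^ n := by
    intro v hv n
    set w : E := ((2 : ℝ) ^ (n + 1))⁻¹ • v with hw
    have hw2 : ((2 : ℝ) ^ n)⁻¹ • v = w + w := by
      rw [← two_smul ℝ w, hw, smul_smul]; congr 1; rw [pow_succ]; field_simp
    have hwn : ‖w‖ = ‖v‖ / 2 ^ (n + 1) := by
      rw [hw, norm_smul, norm_inv, norm_pow, Real.norm_two]; field_simp
    have hwδ : ‖w‖ < δ := by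
      rw [hwn]
      exact (div_le_self (norm_nonneg _) (one_le_pow₀ (by norm_num))).trans_lt hv
    have : a n v - a (n + 1) v = (2 : ℝ) ^ n • (F (w + w) - F w - F w) := by
      simp only [ha]; rw [hw2, ← hw, pow_succ, mul_smul, two_smul, smul_sub, smul_sub, smul_add]
      abel
    rw [dist_eq_norm, this, norm_smul, norm_pow, Real.norm_two]
    refine (mul_le_mul_of_nonneg_left (hadd w w hwδ hwδ) (hpow n).le).trans (le_of_eq ?_)
    rw [hwn, pow_succ]; field_simp
  have hsmall : ∀ v : E, ∃ k : ℕ, ∀ n, k ≤ n → ‖((2 : ℝ) ^ n)⁻¹ • v‖ < δ := by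
    intro v
    have h1 : Filter.Tendsto (fun n : ℕ => ((2 : ℝ) ^ n)⁻¹ • v) Filter.atTop (𝓝 ((0 : ℝ) • v)) :=
      (tendsto_inv_atTop_zero.comp (tendsto_pow_atTop_atTop_of_one_lt (by norm_num))).smul_const v
    rw [zero_smul] at h1
    have h2 := h1.norm.eventually (gt_mem_nhds (by simpa using hδ))
    exact Filter.eventually_atTop.1 h2
  -- For `v` outside the ball, the quotients are $2^k$ times those of $2^{-k}v$, up to a shift of
  -- the index.
  have hlim : ∀ v, ∃ T, Filter.Tendsto (fun n => a n v) Filter.atTop (𝓝 T) := by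
    intro v
    obtain ⟨k, hk⟩ := hsmall v
    obtain ⟨T, hT⟩ := cauchySeq_tendsto_of_complete
      (cauchySeq_of_le_geometric_two (hstep _ (hk k le_rfl)))
    refine ⟨(2 : ℝ) ^ k • T, (Filter.tendsto_add_atTop_iff_nat k).1 ((hT.const_smul ((2 : ℝ) ^ k)).congr
      fun n => ?_)⟩
    simp only [ha, smul_smul]
    rw [pow_add, mul_inv, mul_comm ((2 : ℝ) ^ k)]
  choose T hT using hlim
  have hTadd : ∀ x y, T (x + y) = T x + T y := by
    intro x y
    obtain ⟨k, hk⟩ := hsmall x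
    obtain ⟨k', hk'⟩ := hsmall y
    -- The additivity defect is at most $2^n\cdot C\,4^{-n}\|x\|\|y\|$.
    have h0 : Filter.Tendsto (fun n => a n (x + y) - a n x - a n y) Filter.atTop (𝓝 0) := by
      refine squeeze_zero_norm' (a := fun n : ℕ => ((2 : ℝ) ^ n)⁻¹ * (C * ‖x‖ * ‖y‖)) ?_ ?_
      · filter_upwards [Filter.eventually_ge_atTop (max k k')] with n hn
        have := hadd _ _ (hk n ((le_max_left _ _).trans hn)) (hk' n ((le_max_right _ _).trans hn))
        simp only [ha]
        rw [← smul_sub, ← smul_sub, smul_add, norm_smul, norm_pow, Real.norm_two]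
        refine (mul_le_mul_of_nonneg_left this (hpow n).le).trans (le_of_eq ?_)
        rw [norm_smul, norm_smul, norm_inv, norm_pow, Real.norm_two]
        field_simp
      · have := (tendsto_inv_atTop_zero.comp (tendsto_pow_atTop_atTop_of_one_lt
          (by norm_num : (1 : ℝ) < 2))).mul_const (C * ‖x‖ * ‖y‖)
        simpa using this
    have := tendsto_nhds_unique (((hT (x + y)).sub (hT x)).sub (hT y)) h0
    rw [sub_sub, sub_eq_zero] at this
    exact this
  have hTb : ∀ v, ‖T v‖ ≤ L * ‖v‖ := by
    intro v
    obtain ⟨k, hk⟩ := hsmall v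
    refine le_of_tendsto (hT v).norm ?_
    filter_upwards [Filter.eventually_ge_atTop k] with n hn
    simp only [ha]
    rw [norm_smul, norm_pow, Real.norm_two]
    refine (mul_le_mul_of_nonneg_left (hL _ (hk n hn)) (hpow n).le).trans (le_of_eq ?_)
    rw [norm_smul, norm_inv, norm_pow, Real.norm_two]
    field_simp
  have hquad : ∀ v, ‖v‖ < δ → ‖F v - T v‖ ≤ C / 2 * ‖v‖ ^ 2 := by
    intro v hv
    have := dist_le_of_le_geometric_two_of_tendsto₀ (hstep v hv) (hT v)
    simpa [ha, dist_eq_norm] using this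
  -- A continuous additive map between real normed spaces is real linear, so homogeneity of `T`
  -- needs no separate argument.
  let T' : E →+ A := AddMonoidHom.mk' T hTadd
  have hTc : Continuous T' := AddMonoidHomClass.continuous_of_bound T' L hTb
  refine ⟨T'.toRealLinearMap hTc, ?_⟩
  have hO : (fun v => F v - T'.toRealLinearMap hTc v) =O[𝓝 0] fun v : E => ‖v - 0‖ ^ 2 := by
    refine Asymptotics.IsBigO.of_bound (C / 2) ?_
    filter_upwards [Metric.ball_mem_nhds (0 : E) hδ] with v hv
    rw [sub_zero, Real.norm_of_nonneg (by positivity)]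
    exact hquad v (by simpa using hv)
  have := (hO.hasFDerivAt (by norm_num)).add (T'.toRealLinearMap hTc).hasFDerivAt
  simpa [Function.comp_def, Pi.add_def] using this

/-- A local group law is additive up to an error `O(‖x‖ ‖y‖)`. -/
theorem ContDiffAt.exists_norm_sub_add_le {m : E × E → E} (hm : ContDiffAt ℝ 2 m 0)
    (hm1 : ∀ᶠ x in 𝓝 0, m (x, 0) = x) (hm2 : ∀ᶠ x in 𝓝 0, m (0, x) = x) :
    ∃ C ≥ 0, ∃ δ > 0, ∀ x y, ‖x‖ < δ → ‖y‖ < δ → ‖m (x, y) - (x + y)‖ ≤ C * ‖x‖ * ‖y‖ := by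
  -- This is where two derivatives are used: the first derivative of `m` is Lipschitz near the
  -- origin.
  obtain ⟨K, s, hs, hK⟩ := (hm.fderiv_right (m := 1) (by norm_num)).exists_lipschitzOnWith
  have hd : ∀ᶠ p in 𝓝 (0 : E × E), DifferentiableAt ℝ m p :=
    (hm.eventually (by simp)).mono fun p hp => hp.differentiableAt (by norm_num)
  obtain ⟨δ, hδ, hb⟩ := Metric.mem_nhds_iff.1 (Filter.inter_mem hs hd)
  obtain ⟨δ', hδ', hb'⟩ := Metric.mem_nhds_iff.1 (Filter.inter_mem hm1 hm2)
  refine ⟨K, K.2, min δ δ', lt_min hδ hδ', fun x y hx hy => ?_⟩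
  have hmem : ∀ a b : E, ‖a‖ < min δ δ' → ‖b‖ < min δ δ' → (a, b) ∈ Metric.ball (0 : E × E) δ :=
    fun a b ha hb => by
      rw [mem_ball_zero_iff, Prod.norm_def]
      exact max_lt (ha.trans_le (min_le_left _ _)) (hb.trans_le (min_le_left _ _))
  have h0 : ‖(0 : E)‖ < min δ δ' := by simpa using ⟨hδ, hδ'⟩
  -- The increment of $z\mapsto m(z,y)-m(z,0)$ from $0$ to $x$ is exactly $m(x,y)-x-y$, while its
  -- derivative is $O(\|y\|)$ by the Lipschitz bound; the mean value inequality yields the product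
  -- $\|x\|\|y\|$.
  have key := (convex_ball (0 : E) (min δ δ')).norm_image_sub_le_of_norm_hasFDerivWithin_le
    (f := fun z => m (z, y) - m (z, 0)) (C := K * ‖y‖)
    (f' := fun z => (fderiv ℝ m (z, y) - fderiv ℝ m (z, 0)) ∘L ContinuousLinearMap.inl ℝ E E)
    (x := 0) (y := x) ?_ ?_ (by simpa using h0) (by simpa using hx)
  · have e1 : m (x, 0) = x := (hb' (by simpa using hx.trans_le (min_le_right _ _))).1
    have e2 : m (0, y) = y := (hb' (by simpa using hy.trans_le (min_le_right _ _))).2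
    have e3 : m (0, 0) = 0 := (hb' (by simpa using hδ')).2
    rw [e1, e2, e3] at key
    have : m (x, y) - (x + y) = m (x, y) - x - (y - 0) := by abel
    rw [this]
    refine key.trans (le_of_eq ?_)
    rw [sub_zero]; ring
  · intro z hz
    have hz' : ‖z‖ < min δ δ' := by simpa using hz
    have d1 : ∀ b, ‖b‖ < min δ δ' → HasFDerivAt (fun z => m (z, b))
        (fderiv ℝ m (z, b) ∘L ContinuousLinearMap.inl ℝ E E) z := fun b hb0 =>
      ((hb (hmem z b hz' hb0)).2.hasFDerivAt).comp z (hasFDerivAt_prodMk_left z b)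
    rw [ContinuousLinearMap.sub_comp]
    exact ((d1 y hy).sub (d1 0 h0)).hasFDerivWithinAt
  · intro z hz
    have hz' : ‖z‖ < min δ δ' := by simpa using hz
    refine (ContinuousLinearMap.opNorm_comp_le _ _).trans ?_
    have h1 := hK.dist_le_mul (z, y) (hb (hmem z y hz' hy)).1 (z, 0) (hb (hmem z 0 hz' h0)).1
    have h2 : Dist.dist (z, y) (z, (0 : E)) = ‖y‖ := by simp [Prod.dist_eq]
    rw [h2, dist_eq_norm] at h1
    calc _ ≤ (K * ‖y‖) * 1 := mul_le_mul h1 (ContinuousLinearMap.norm_inl_le_one ℝ E E)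
          (norm_nonneg _) (by positivity)
      _ = _ := mul_one _

variable {A : Type*} [NormedRing A] [NormedAlgebra ℝ A]

/-- A multiplicative map that is close to `1` on a ball of a local group satisfies a Lipschitz
estimate at the origin, because its powers stay close to `1`. -/
theorem norm_sub_one_le_of_local_mul {E : Type*} [NormedAddCommGroup E] {f : E → A} {m : E × E → E} {C δ : ℝ} (hC : 0 ≤ C)
    (hδ : 0 < δ) (hCδ : C * δ ≤ 1) (hf0 : f 0 = 1)
    (hm : ∀ x y, ‖x‖ < δ → ‖y‖ < δ → ‖m (x, y) - (x + y)‖ ≤ C * ‖x‖ * ‖y‖)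
    (hf : ∀ x, ‖x‖ < δ → ‖f x - 1‖ ≤ 1 / 2)
    (hfm : ∀ x y, ‖x‖ < δ → ‖y‖ < δ → f (m (x, y)) = f x * f y) {x : E} (hx : ‖x‖ < δ / 6) :
    ‖f x - 1‖ ≤ 6 / δ * ‖x‖ := by
  rcases eq_or_ne x 0 with rfl | hx0
  · simp [hf0]
  have hxp : 0 < ‖x‖ := norm_pos_iff.2 hx0
  have hxδ : ‖x‖ < δ := by linarith
  -- The `k`-th local power of `x` is reached by $z\mapsto m(z,x)$. Each step adds at most $2\|x\|$
  -- to the norm, because $C\|z\|\le C\delta\le1$.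
  have hpow : ∀ k : ℕ, 2 * k * ‖x‖ < δ → ∃ z, ‖z‖ ≤ 2 * k * ‖x‖ ∧ f z = f x ^ k := by
    intro k
    induction k with
    | zero => intro _; exact ⟨0, by simp, by simp [hf0]⟩
    | succ k ih =>
      intro hk
      push_cast at hk ⊢
      obtain ⟨z, hz, hfz⟩ := ih (by nlinarith)
      have hzδ : ‖z‖ < δ := by nlinarith
      refine ⟨m (z, x), ?_, by rw [hfm z x hzδ hxδ, hfz, pow_succ]⟩
      have h1 := hm z x hzδ hxδ
      have h2 : ‖m (z, x)‖ ≤ ‖m (z, x) - (z + x)‖ + (‖z‖ + ‖x‖) := by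
        calc ‖m (z, x)‖ = ‖(m (z, x) - (z + x)) + (z + x)‖ := by simp
          _ ≤ _ := (norm_add_le _ _).trans (by gcongr; exact norm_add_le _ _)
      have h3 : C * ‖z‖ * ‖x‖ ≤ 1 * ‖x‖ := by
        gcongr
        exact (mul_le_mul_of_nonneg_left hzδ.le hC).trans hCδ
      linarith
  -- The `3` keeps $2n\|x\|\le\frac23\delta<\delta$, so the first `n` powers stay in the ball. Since
  -- $\|x\|<\delta/6$, the quotient exceeds $2$, and rounding down still leaves
  -- $n\ge\delta/(6\|x\|)$.
  set n : ℕ := ⌊δ / (3 * ‖x‖)⌋₊ with hn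
  have hn1 : (n : ℝ) ≤ δ / (3 * ‖x‖) := Nat.floor_le (by positivity)
  have hn2 : δ / (3 * ‖x‖) < n + 1 := Nat.lt_floor_add_one _
  rw [le_div_iff₀ (by positivity)] at hn1
  rw [div_lt_iff₀ (by positivity)] at hn2
  have hnp : ∀ k : ℕ, k ≤ n → ‖f x ^ k - 1‖ ≤ 1 / 2 := by
    intro k hk
    have hk' : (k : ℝ) * ‖x‖ ≤ n * ‖x‖ := by gcongr
    have hlt : 2 * (k : ℝ) * ‖x‖ < δ := by nlinarith
    obtain ⟨z, hz, hfz⟩ := hpow k hlt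
    rw [← hfz]
    exact hf z (hz.trans_lt hlt)
  have hsum : ‖(∑ i ∈ Finset.range n, f x ^ i) - n‖ ≤ n / 2 := by
    have : (∑ i ∈ Finset.range n, f x ^ i) - (n : A) = ∑ i ∈ Finset.range n, (f x ^ i - 1) := by
      simp
    rw [this]
    refine (norm_sum_le_of_le _ fun i hi => hnp i (Finset.mem_range.1 hi).le).trans (le_of_eq ?_)
    simp; ring
  have hgeom : n • ‖f x - 1‖ ≤ 1 / 2 + ‖f x - 1‖ * (n / 2) := by
    -- The geometric sum of the powers is within `n / 2` of `n`, so $f(x)^n-1$ controls $n(f(x)-1)$: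
    -- the last term is absorbed and $n\|f(x)-1\|\le1$ remains.
    have e : n • (f x - 1) = (f x ^ n - 1) -
        (f x - 1) * ((∑ i ∈ Finset.range n, f x ^ i) - n) := by
      rw [mul_sub, mul_geom_sum, nsmul_eq_mul, (Nat.cast_commute n (f x - 1)).eq]; abel
    have h1 : ‖(f x - 1) * ((∑ i ∈ Finset.range n, f x ^ i) - n)‖ ≤ ‖f x - 1‖ * (n / 2) :=
      (norm_mul_le _ _).trans (by gcongr)
    rw [← RCLike.norm_nsmul ℝ, e]
    exact (norm_sub_le _ _).trans (add_le_add (hnp n le_rfl) h1)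
  rw [nsmul_eq_mul] at hgeom
  rw [div_mul_eq_mul_div, le_div_iff₀ hδ]
  nlinarith [norm_nonneg (f x - 1)]

/-- A continuous multiplicative map from a local group, with multiplication `m` and left division
`ψ`, to a Banach algebra is differentiable at the origin. -/
theorem exists_hasFDerivAt_of_local_mul [CompleteSpace A] {f : E → A} {m ψ : E × E → E}
    (hm : ContDiffAt ℝ 2 m 0) (hm1 : ∀ᶠ x in 𝓝 0, m (x, 0) = x) (hm2 : ∀ᶠ x in 𝓝 0, m (0, x) = x)
    (hψ : ContDiffAt ℝ 1 ψ 0) (hψ0 : ∀ᶠ x in 𝓝 0, ψ (x, x) = 0)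
    (hf : ContinuousAt f 0) (hf0 : f 0 = 1)
    (hfm : ∀ᶠ p : E × E in 𝓝 0, f (m p) = f p.1 * f p.2)
    (hfψ : ∀ᶠ p : E × E in 𝓝 0, f p.2 = f p.1 * f (ψ p)) :
    ∃ f' : E →L[ℝ] A, HasFDerivAt f f' 0 := by
  obtain ⟨C, hC, δ₁, hδ₁, hmC⟩ := hm.exists_norm_sub_add_le hm1 hm2
  obtain ⟨K, s, hs, hK⟩ := hψ.exists_lipschitzOnWith
  obtain ⟨δ₂, hδ₂, h₂⟩ := Metric.mem_nhds_iff.1 (Filter.inter_mem hs (Filter.inter_mem hfm hfψ))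
  obtain ⟨δ₃, hδ₃, h₃⟩ := Metric.mem_nhds_iff.1 (Filter.inter_mem hψ0
    (hf.preimage_mem_nhds (by rw [hf0]; exact Metric.ball_mem_nhds (1 : A) (half_pos one_pos))))
  -- a radius on which all estimates hold
  obtain ⟨δ, hδ, hd1, hd2, hd3, hCδ⟩ : ∃ δ > 0, δ ≤ δ₁ ∧ δ ≤ δ₂ ∧ δ ≤ δ₃ ∧ C * δ ≤ 1 := by
    refine ⟨min (min δ₁ δ₂) (min δ₃ (1 / (C + 1))), by positivity,
      (min_le_left _ _).trans (min_le_left _ _), (min_le_left _ _).trans (min_le_right _ _),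
      (min_le_right _ _).trans (min_le_left _ _), ?_⟩
    refine (mul_le_mul_of_nonneg_left ((min_le_right _ _).trans (min_le_right _ _)) hC).trans ?_
    rw [mul_one_div, div_le_one (by positivity)]
    linarith
  have hp : ∀ x y : E, ‖x‖ < δ → ‖y‖ < δ → (x, y) ∈ s ∩ _ := fun x y hx hy =>
    h₂ (by
      rw [mem_ball_zero_iff, Prod.norm_def]
      exact max_lt (hx.trans_le hd2) (hy.trans_le hd2))
  have hx3 : ∀ x : E, ‖x‖ < δ → _ := fun x hx =>
    h₃ (mem_ball_zero_iff.2 (hx.trans_le hd3))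
  have hm' : ∀ x y, ‖x‖ < δ → ‖y‖ < δ → ‖m (x, y) - (x + y)‖ ≤ C * ‖x‖ * ‖y‖ :=
    fun x y hx hy => hmC x y (hx.trans_le hd1) (hy.trans_le hd1)
  have hf' : ∀ x, ‖x‖ < δ → ‖f x - 1‖ ≤ 1 / 2 := fun x hx => by
    have : f x ∈ Metric.ball (1 : A) (1 / 2) := (hx3 x hx).2
    rw [mem_ball_iff_norm] at this
    exact this.le
  have hfm' : ∀ x y, ‖x‖ < δ → ‖y‖ < δ → f (m (x, y)) = f x * f y :=
    fun x y hx hy => (hp x y hx hy).2.1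
  have hL : ∀ x, ‖x‖ < δ / 6 → ‖f x - 1‖ ≤ 6 / δ * ‖x‖ := fun x hx =>
    norm_sub_one_le_of_local_mul hC hδ hCδ hf0 hm' hf' hfm' hx
  -- Left division vanishes on the diagonal, so its Lipschitz bound measures the distance of its two
  -- arguments.
  have hψK : ∀ a b : E, ‖a‖ < δ → ‖b‖ < δ → ‖ψ (a, b)‖ ≤ K * ‖a - b‖ := by
    intro a b ha hb
    have h1 := hK.norm_sub_le (hp a b ha hb).1 (hp a a ha ha).1
    have h0 : ψ (a, a) = 0 := (hx3 a ha).1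
    rw [h0, sub_zero] at h1
    refine h1.trans (le_of_eq ?_)
    simp [Prod.norm_def, norm_sub_rev]
  -- For $\|x\|,\|y\|<r$ one has $\|x+y\|<2r$ and $\|m(x,y)\|<3r$, well inside the `δ`-ball. The
  -- factor `K + 1` makes $\psi(m(x,y),x+y)$ shorter than $\delta/6$, as the Lipschitz estimate `hL`
  -- requires.
  set r : ℝ := min (δ / 6) (δ / 6 / (K + 1)) / 3 with hr
  have hr0 : 0 < r := by positivity
  have hr1 : 3 * r ≤ δ / 6 := by rw [hr]; linarith [min_le_left (δ / 6) (δ / 6 / (K + 1 : ℝ))]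
  have hr2 : (K + 1) * (3 * r) ≤ δ / 6 := by
    have := min_le_right (δ / 6) (δ / 6 / (K + 1 : ℝ))
    rw [← le_div_iff₀' (by positivity), hr]
    linarith
  have key := exists_hasFDerivAt_zero_of_quasiadditive (F := fun x => f x - 1)
    (C := (‖(1 : A)‖ + 1 / 2) * (6 / δ * (K * C)) + 6 / δ * (6 / δ)) (L := 6 / δ) hr0 ?_
    (fun x hx => hL x (by linarith))
  · obtain ⟨F', hF'⟩ := key
    exact ⟨F', by simpa using hF'.add_const (1 : A)⟩
  · intro x y hx hy
    have hxδ : ‖x‖ < δ := by linarith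
    have hyδ : ‖y‖ < δ := by linarith
    have hmxy := hm' x y hxδ hyδ
    have hxy : ‖x + y‖ < 2 * r := (norm_add_le x y).trans_lt (by linarith)
    have hC1 : C * ‖x‖ * ‖y‖ ≤ ‖y‖ := by
      have : C * ‖x‖ ≤ 1 := (mul_le_mul_of_nonneg_left hxδ.le hC).trans hCδ
      nlinarith [norm_nonneg y]
    have hmδ : ‖m (x, y)‖ < 3 * r := by
      calc ‖m (x, y)‖ = ‖(m (x, y) - (x + y)) + (x + y)‖ := by simp
        _ ≤ _ := norm_add_le _ _
        _ < _ := by linarith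
    have hψ1 := hψK (m (x, y)) (x + y) (by linarith) (by linarith)
    have hψ2 : ‖ψ (m (x, y), x + y)‖ ≤ K * C * ‖x‖ * ‖y‖ :=
      hψ1.trans ((mul_le_mul_of_nonneg_left hmxy K.2).trans
        (le_of_eq (by simp only [mul_assoc]; rfl)))
    have hψ3 : ‖ψ (m (x, y), x + y)‖ < δ / 6 := by
      have : (K : ℝ) * ‖m (x, y) - (x + y)‖ ≤ K * r :=
        mul_le_mul_of_nonneg_left (by linarith) K.2
      nlinarith [K.2]
    -- The vector sum is compared with the group product: the correcting factor is `f` at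
    -- $\psi(m(x,y),x+y)$, a point of size $O(\|x\|\|y\|)$.
    have e1 : f (x + y) = f (m (x, y)) * f (ψ (m (x, y), x + y)) :=
      (hp (m (x, y)) (x + y) (by linarith) (by linarith)).2.2
    have e2 : f (x + y) - 1 - (f x - 1) - (f y - 1) =
        f (m (x, y)) * (f (ψ (m (x, y), x + y)) - 1) + (f x - 1) * (f y - 1) := by
      rw [mul_sub, ← e1, hfm' x y hxδ hyδ]; noncomm_ring
    have b1 : ‖f (m (x, y))‖ ≤ ‖(1 : A)‖ + 1 / 2 := by
      calc ‖f (m (x, y))‖ = ‖1 + (f (m (x, y)) - 1)‖ := by simp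
        _ ≤ _ := (norm_add_le _ _).trans (by gcongr; exact hf' _ (by linarith))
    have b2 : ‖f (ψ (m (x, y), x + y)) - 1‖ ≤ 6 / δ * (K * C * ‖x‖ * ‖y‖) :=
      (hL _ hψ3).trans (by gcongr)
    rw [e2]
    calc _ ≤ ‖f (m (x, y))‖ * ‖f (ψ (m (x, y), x + y)) - 1‖ + ‖f x - 1‖ * ‖f y - 1‖ :=
          (norm_add_le _ _).trans (add_le_add (norm_mul_le _ _) (norm_mul_le _ _))
      _ ≤ (‖(1 : A)‖ + 1 / 2) * (6 / δ * (K * C * ‖x‖ * ‖y‖)) +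
          (6 / δ * ‖x‖) * (6 / δ * ‖y‖) := by
        gcongr
        · exact hL x (by linarith)
        · exact hL y (by linarith)
      _ = _ := by ring

/-- A map `f` on an open set that is differentiable at the origin and satisfies
`f y = f x * f (ψ (x, y))` for `y` near `x`, where `ψ` is smooth with `ψ (x, x) = 0`, is smooth. -/
theorem contDiffOn_infty_of_local_mul {f : E → A} {ψ : E × E → E} {U : Set E} {W : Set (E × E)}
    (hU : IsOpen U) (hW : IsOpen W) (hUW : ∀ x ∈ U, (x, x) ∈ W) (hψ : ContDiffOn ℝ ∞ ψ W)
    (hψ0 : ∀ x ∈ U, ψ (x, x) = 0) (hfψ : ∀ p ∈ W, f p.2 = f p.1 * f (ψ p))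
    {f' : E →L[ℝ] A} (hf' : HasFDerivAt f f' 0) : ContDiffOn ℝ ∞ f U := by
  -- Differentiating $f(y)=f(x)f(\psi(x,y))$ in `y` at $y=x$ involves only the derivative of `f` at
  -- $\psi(x,x)=0$.
  set Df : E → E →L[ℝ] A := fun x => (ContinuousLinearMap.mul ℝ A (f x)) ∘L
    (f' ∘L (fderiv ℝ ψ (x, x) ∘L ContinuousLinearMap.inr ℝ E E)) with hDf
  have hderiv : ∀ x ∈ U, HasFDerivAt f (Df x) x := by
    intro x hx
    have h1 : HasFDerivAt ψ (fderiv ℝ ψ (x, x)) (x, x) :=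
      ((hψ.contDiffAt (hW.mem_nhds (hUW x hx))).differentiableAt (by simp)).hasFDerivAt
    have h2 : HasFDerivAt (fun y => ψ (x, y)) (fderiv ℝ ψ (x, x) ∘L ContinuousLinearMap.inr ℝ E E) x :=
      h1.comp x (hasFDerivAt_prodMk_right x x)
    have h3 : HasFDerivAt f f' (ψ (x, x)) := by rw [hψ0 x hx]; exact hf'
    have h4 := (ContinuousLinearMap.mul ℝ A (f x)).hasFDerivAt.comp x (h3.comp x h2)
    refine h4.congr_of_eventuallyEq ?_
    have hc : ContinuousAt (fun y : E => (x, y)) x := by fun_prop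
    filter_upwards [hc.preimage_mem_nhds (hW.mem_nhds (hUW x hx))] with y hy
    exact hfψ (x, y) hy
  have hψ' : ContDiffOn ℝ ∞ (fun x => fderiv ℝ ψ (x, x) ∘L ContinuousLinearMap.inr ℝ E E) U := by
    have h1 : ContDiffOn ℝ ∞ (fderiv ℝ ψ) W := hψ.fderiv_of_isOpen hW (by simp)
    have h2 : ContDiffOn ℝ ∞ (fun x => fderiv ℝ ψ (x, x)) U :=
      h1.comp (contDiff_id.prodMk contDiff_id).contDiffOn hUW
    exact h2.clm_comp contDiffOn_const
  -- Bootstrapping: in the formula `Df`, everything except the factor $f(x)$ is smooth, so `Df`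
  -- inherits the regularity of `f`, which then gains one order.
  have hall : ∀ n : ℕ, ContDiffOn ℝ n f U := by
    intro n
    induction n with
    | zero =>
      exact contDiffOn_zero.2 fun x hx => (hderiv x hx).continuousAt.continuousWithinAt
    | succ n ih =>
      have : ((n + 1 : ℕ) : WithTop ℕ∞) = (n : WithTop ℕ∞) + 1 := by push_cast; rfl
      rw [this, contDiffOn_succ_iff_hasFDerivWithinAt_of_uniqueDiffOn hU.uniqueDiffOn]
      refine ⟨by simp, Df, ?_, fun x hx => (hderiv x hx).hasFDerivWithinAt⟩
      refine ContDiffOn.clm_comp ((ContinuousLinearMap.mul ℝ A).contDiff.comp_contDiffOn ih) ?_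
      exact contDiffOn_const.clm_comp (hψ'.of_le (by exact_mod_cast le_top))
  exact contDiffOn_infty.2 hall

end LocalGroup

/-! ### Automatic smoothness of norm-continuous homomorphisms -/

section LieGroup

variable {E : Type*} [NormedAddCommGroup E] [NormedSpace ℝ E]
  {G : Type*} [Group G] [TopologicalSpace G] [ChartedSpace E G] [LieGroup 𝓘(ℝ, E) ∞ G]
  {A : Type*} [NormedRing A] [NormedAlgebra ℝ A] [CompleteSpace A]

/-- A norm-continuous homomorphism from a Banach-Lie group into a Banach algebra is smooth. -/
theorem MonoidHom.contMDiff_of_continuous (f : G →* A) (hf : Continuous f) :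
    ContMDiff 𝓘(ℝ, E) 𝓘(ℝ, A) ∞ f := by
  have : IsTopologicalGroup G := topologicalGroup_of_lieGroup 𝓘(ℝ, E) ∞
  -- By $f(x)=f(g)f(g^{-1}x)$, left translation carries smoothness at the identity to every point.
  suffices h1 : ContMDiffAt 𝓘(ℝ, E) 𝓘(ℝ, A) ∞ f 1 by
    intro g
    have e : (f : G → A) = fun x => f g * f (g⁻¹ * x) := by
      funext x; rw [← map_mul, mul_inv_cancel_left]
    rw [e]
    have h2 : ContMDiffAt 𝓘(ℝ, E) 𝓘(ℝ, A) ∞ f (g⁻¹ * g) := by rwa [inv_mul_cancel]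
    have h3 : ContMDiffAt 𝓘(ℝ, E) 𝓘(ℝ, A) ∞ (fun x => f (g⁻¹ * x)) g :=
      h2.comp g (contMDiff_mul_left (a := g⁻¹)).contMDiffAt
    exact (ContinuousLinearMap.mul ℝ A (f g)).contDiff.contMDiff.contMDiffAt.comp g h3
  set φ := chartAt E (1 : G) with hφdef
  have hφ : φ ∈ IsManifold.maximalAtlas 𝓘(ℝ, E) ∞ G := IsManifold.chart_mem_maximalAtlas 1
  have h1 : (1 : G) ∈ φ.source := mem_chart_source E 1
  have hs := contMDiffOn_symm_of_mem_maximalAtlas hφ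
  have hc := contMDiffOn_of_mem_maximalAtlas hφ
  have ht : φ 1 ∈ φ.target := φ.map_source h1
  -- The inverse chart is shifted so that the origin corresponds to the identity; the local group
  -- law then has unit $0$.
  set γ : E → G := fun x => φ.symm (φ 1 + x) with hγ
  set U : Set E := (fun x => φ 1 + x) ⁻¹' φ.target with hUdef
  have hU : IsOpen U := φ.open_target.preimage (by fun_prop)
  have h0U : (0 : E) ∈ U := by simpa [hUdef] using ht
  have hγ0 : γ 0 = 1 := by simp [hγ, φ.left_inv h1]
  have hγs : ContMDiffOn 𝓘(ℝ, E) 𝓘(ℝ, E) ∞ γ U :=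
    hs.comp (contDiff_const.add contDiff_id).contMDiff.contMDiffOn fun x hx => hx
  have hφγ : ∀ x ∈ U, φ (γ x) - φ 1 = x := fun x hx => by
    simp only [hγ]; rw [φ.right_inv hx, add_sub_cancel_left]
  have hγφ : ∀ g ∈ φ.source, γ (φ g - φ 1) = g := fun g hg => by
    simp [hγ, φ.left_inv hg]
  have hγ1 : ContMDiffOn 𝓘(ℝ, E × E) 𝓘(ℝ, E) ∞ (fun p : E × E => γ p.1) (U ×ˢ U) :=
    hγs.comp contDiff_fst.contMDiff.contMDiffOn fun p hp => hp.1
  have hγ2 : ContMDiffOn 𝓘(ℝ, E × E) 𝓘(ℝ, E) ∞ (fun p : E × E => γ p.2) (U ×ˢ U) :=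
    hγs.comp contDiff_snd.contMDiff.contMDiffOn fun p hp => hp.2
  -- a smooth map `U × U → G`, read in the chart
  have hread : ∀ k : E × E → G, ContMDiffOn 𝓘(ℝ, E × E) 𝓘(ℝ, E) ∞ k (U ×ˢ U) →
      IsOpen ((U ×ˢ U) ∩ k ⁻¹' φ.source) ∧
      ContDiffOn ℝ ∞ (fun p => φ (k p) - φ 1) ((U ×ˢ U) ∩ k ⁻¹' φ.source) := by
    intro k hk
    refine ⟨hk.continuousOn.isOpen_inter_preimage (hU.prod hU) φ.open_source, ?_⟩
    exact (contMDiffOn_iff_contDiffOn.1 (hc.comp (hk.mono Set.inter_subset_left)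
      fun p hp => hp.2)).sub contDiffOn_const
  -- These read multiplication $gh$ and left division $g^{-1}h$ in the chart; they play the roles of
  -- `m` and `ψ`.
  obtain ⟨hWm, hm⟩ := hread _ (hγ1.mul hγ2)
  obtain ⟨hWψ, hψ⟩ := hread _ (hγ1.inv.mul hγ2)
  have h0m : (0 : E × E) ∈ (U ×ˢ U) ∩ (fun p : E × E => γ p.1 * γ p.2) ⁻¹' φ.source :=
    ⟨⟨h0U, h0U⟩, by simpa [hγ0] using h1⟩
  have hxψ : ∀ x ∈ U, (x, x) ∈ (U ×ˢ U) ∩ (fun p : E × E => (γ p.1)⁻¹ * γ p.2) ⁻¹' φ.source :=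
    fun x hx => ⟨⟨hx, hx⟩, by simpa using h1⟩
  have hfψ : ∀ p ∈ (U ×ˢ U) ∩ (fun p : E × E => (γ p.1)⁻¹ * γ p.2) ⁻¹' φ.source,
      f (γ p.2) = f (γ p.1) * f (γ (φ ((γ p.1)⁻¹ * γ p.2) - φ 1)) := by
    intro p hp
    rw [hγφ _ hp.2, ← map_mul, mul_inv_cancel_left]
  have hUn : U ∈ 𝓝 (0 : E) := hU.mem_nhds h0U
  have hle : (2 : WithTop ℕ∞) ≤ ∞ := WithTop.coe_le_coe.2 (le_top : (2 : ℕ∞) ≤ ⊤)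
  obtain ⟨f', hf'⟩ := exists_hasFDerivAt_of_local_mul (f := fun x => f (γ x))
    (m := fun p => φ (γ p.1 * γ p.2) - φ 1) (ψ := fun p => φ ((γ p.1)⁻¹ * γ p.2) - φ 1)
    ((hm.contDiffAt (hWm.mem_nhds h0m)).of_le hle)
    (by filter_upwards [hUn] with x hx; simpa [hγ0] using hφγ x hx)
    (by filter_upwards [hUn] with x hx; simpa [hγ0] using hφγ x hx)
    ((hψ.contDiffAt (hWψ.mem_nhds (hxψ 0 h0U))).of_le (by exact_mod_cast le_top))
    (Filter.Eventually.of_forall fun x => by simp)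
    (hf.continuousAt.comp (hγs.continuousOn.continuousAt hUn)) (by simp [hγ0])
    (by filter_upwards [hWm.mem_nhds h0m] with p hp
        exact (congrArg f (hγφ (γ p.1 * γ p.2) hp.2)).trans (map_mul f _ _))
    (by filter_upwards [hWψ.mem_nhds (hxψ 0 h0U)] with p hp; exact hfψ p hp)
  have hsm := contDiffOn_infty_of_local_mul hU hWψ hxψ hψ (fun x _ => by simp) hfψ hf'
  have h5 : ContMDiffAt 𝓘(ℝ, E) 𝓘(ℝ, A) ∞ (fun x => f (γ x)) (φ 1 - φ 1) := by
    rw [sub_self]; exact (hsm.contDiffAt hUn).contMDiffAt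
  have h6 : ContMDiffAt 𝓘(ℝ, E) 𝓘(ℝ, E) ∞ (fun g => φ g - φ 1) (1 : G) :=
    (contDiff_id.sub contDiff_const).contMDiff.contMDiffAt.comp (1 : G)
      (hc.contMDiffAt (φ.open_source.mem_nhds h1))
  refine (h5.comp (1 : G) h6).congr_of_eventuallyEq ?_
  filter_upwards [φ.open_source.mem_nhds h1] with g hg
  simp only [Function.comp_apply]
  rw [hγφ g hg]

end LieGroup

/-! ### Real smoothness of compositions of complex operators -/

section ComplexLinear

variable {EM : Type*} [NormedAddCommGroup EM] [NormedSpace ℝ EM] {HM : Type*} [TopologicalSpace HM]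
  {I : ModelWithCorners ℝ EM HM} {Z : Type*} [TopologicalSpace Z] [ChartedSpace HM Z]
  {V₁ V₂ V₃ : Type*} [NormedAddCommGroup V₁] [NormedSpace ℂ V₁] [NormedAddCommGroup V₂]
  [NormedSpace ℂ V₂] [NormedAddCommGroup V₃] [NormedSpace ℂ V₃]

/-- Composition of complex linear operators preserves smoothness over the reals. -/
theorem ContMDiffOn.complexCLM_comp {n : WithTop ℕ∞} {f : Z → V₂ →L[ℂ] V₃} {g : Z → V₁ →L[ℂ] V₂}
    {s : Set Z} (hf : ContMDiffOn I 𝓘(ℝ, V₂ →L[ℂ] V₃) n f s)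
    (hg : ContMDiffOn I 𝓘(ℝ, V₁ →L[ℂ] V₂) n g s) :
    ContMDiffOn I 𝓘(ℝ, V₁ →L[ℂ] V₃) n (fun z => f z ∘L g z) s :=
  ((isBoundedBilinearMap_comp (𝕜 := ℂ) (E := V₁) (F := V₂)
    (G := V₃)).contDiff.restrict_scalars ℝ).contMDiff.comp_contMDiffOn (hf.prodMk_space hg)

end ComplexLinear

/-! ### Smooth maps into the Grassmannian -/

namespace Gr

variable {H : Type*} [NormedAddCommGroup H] [InnerProductSpace ℂ H] [CompleteSpace H]
  {V : Type*} [NormedAddCommGroup V] [NormedSpace ℂ V]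

/-- The chart centered at `S` applied to the range of an operator `J`. -/
theorem chart_eq_of_equiv (S T : Gr H) (J : V →L[ℂ] H) (j : V ≃L[ℂ] T.1)
    (hj : T.1.subtypeL ∘L (j : V →L[ℂ] T.1) = J) :
    chart S T = (S.1ᗮ.orthogonalProjectionOnto ∘L J) ∘L
      (S.1.orthogonalProjectionOnto ∘L J).inverse := by
  subst hj
  -- The parametrization `j` cancels against its inverse. This is valid even where `inverse` takes
  -- its default value $0$, so membership in the chart domain is not required.
  rw [← ContinuousLinearMap.comp_assoc S.1.orthogonalProjectionOnto,
    ContinuousLinearMap.inverse_comp_equiv]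
  ext x
  simp [chart]

/-- The range of an injective operator `J` lies in the domain of the chart centered at `S` if and
only if the orthogonal projection onto `S` restricts to an isomorphism on it. -/
theorem mem_chartDomain_iff [CompleteSpace V] (S T : Gr H) (J : V →L[ℂ] H) (hJ : Function.Injective J)
    (hT : ∀ x, x ∈ T.1 ↔ ∃ f, J f = x) :
    T ∈ chartDomain S ↔ S.1.orthogonalProjectionOnto ∘L J ∈
      Set.range ((↑) : (V ≃L[ℂ] S.1) → V →L[ℂ] S.1) := by
  constructor
  · intro h
    have hc : IsCompl T.1 S.1ᗮ := h
    -- Injectivity comes from $T\cap S^\perp=0$, surjectivity from $T+S^\perp=H$; the open mapping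
    -- theorem supplies the bounded inverse.
    refine ⟨ContinuousLinearEquiv.ofBijective (S.1.orthogonalProjectionOnto ∘L J) ?_ ?_,
      ContinuousLinearEquiv.coe_ofBijective _ _ _⟩
    · rw [LinearMap.ker_eq_bot']
      intro f hf
      have h1 : J f ∈ S.1ᗮ := Submodule.orthogonalProjectionOnto_eq_zero_iff.1 hf
      have h2 : J f = 0 := by
        simpa using (Submodule.disjoint_def.1 hc.disjoint) _ ((hT _).2 ⟨f, rfl⟩) h1
      exact hJ (by simpa using h2)
    · rw [LinearMap.range_eq_top]
      intro x
      obtain ⟨t, ht, y, hy, hxy⟩ := Submodule.mem_sup.1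
        (hc.sup_eq_top ▸ Submodule.mem_top : (x : H) ∈ T.1 ⊔ S.1ᗮ)
      obtain ⟨f, rfl⟩ := (hT t).1 ht
      refine ⟨f, ?_⟩
      have h3 : S.1.orthogonalProjectionOnto y = 0 :=
        Submodule.orthogonalProjectionOnto_eq_zero_iff.2 hy
      have h4 := congrArg S.1.orthogonalProjectionOnto hxy
      rw [map_add, h3, add_zero, Submodule.orthogonalProjectionOnto_mem_subspace_eq_self] at h4
      exact h4
  · rintro ⟨e, he⟩
    have he' : ∀ f, S.1.orthogonalProjectionOnto (J f) = e f := fun f =>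
      (congrArg (fun L : V →L[ℂ] S.1 => L f) he).symm
    refine IsCompl.of_le ?_ ?_
    · rintro x ⟨hx, hx'⟩
      obtain ⟨f, rfl⟩ := (hT x).1 hx
      have h1 := Submodule.orthogonalProjectionOnto_eq_zero_iff.2 hx'
      rw [he', ContinuousLinearEquiv.map_eq_zero_iff] at h1
      simp [h1]
    · intro x _
      -- The `T`-component of `x` must have the same projection to `S` as `x`, which determines `f`.
      set f := e.symm (S.1.orthogonalProjectionOnto x) with hf
      have h1 : x - J f ∈ S.1ᗮ := by
        rw [← Submodule.orthogonalProjectionOnto_eq_zero_iff, map_sub, he', hf,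
          ContinuousLinearEquiv.apply_symm_apply, sub_self]
      rw [← add_sub_cancel (J f) x]
      exact Submodule.add_mem_sup ((hT _).2 ⟨f, rfl⟩) h1

/-- A map into the Grassmann manifold is smooth if it is locally given by the ranges of a smooth
family of isometries. -/
theorem isSmoothMap_of_isometry [CompleteSpace V] {M : Type*} [NormedAddCommGroup M] [NormedSpace ℝ M]
    {Z : Type*} [TopologicalSpace Z] [ChartedSpace M Z] {ζ : Z → Gr H}
    (hζ : ∀ z₀, ∃ U, IsOpen U ∧ z₀ ∈ U ∧ ∃ J : Z → V →L[ℂ] H,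
      ContMDiffOn 𝓘(ℝ, M) 𝓘(ℝ, V →L[ℂ] H) ∞ J U ∧
      ∀ z ∈ U, (∀ f, ‖J z f‖ = ‖f‖) ∧ ∀ x, x ∈ (ζ z).1 ↔ ∃ f, J z f = x) :
    IsSmoothMap (M := M) ζ := by
  intro S
  have key : ∀ z₀ ∈ ζ ⁻¹' chartDomain S, ∃ W, IsOpen W ∧ z₀ ∈ W ∧ W ⊆ ζ ⁻¹' chartDomain S ∧
      ContMDiffOn 𝓘(ℝ, M) 𝓘(ℝ, S.1 →L[ℂ] S.1ᗮ) ∞ (fun z => chart S (ζ z)) W := by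
    intro z₀ hz₀
    obtain ⟨U, hU, hz₀U, J, hJ, hJζ⟩ := hζ z₀
    have hinj : ∀ z ∈ U, Function.Injective (J z) := fun z hz =>
      (AddMonoidHomClass.isometry_of_norm (J z) (hJζ z hz).1).injective
    have hmem : ∀ z ∈ U, ζ z ∈ chartDomain S ↔ _ := fun z hz =>
      mem_chartDomain_iff S (ζ z) (J z) (hinj z hz) (hJζ z hz).2
    have h1 : ContMDiffOn 𝓘(ℝ, M) 𝓘(ℝ, V →L[ℂ] S.1) ∞
        (fun z => S.1.orthogonalProjectionOnto ∘L J z) U :=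
      ContMDiffOn.complexCLM_comp contMDiffOn_const hJ
    have h2 : ContMDiffOn 𝓘(ℝ, M) 𝓘(ℝ, V →L[ℂ] S.1ᗮ) ∞
        (fun z => S.1ᗮ.orthogonalProjectionOnto ∘L J z) U :=
      ContMDiffOn.complexCLM_comp contMDiffOn_const hJ
    -- Invertible operators form an open set on which inversion is smooth. This gives both openness
    -- of the preimage of the chart domain and smoothness of the chart expression.
    set W := U ∩ (fun z => S.1.orthogonalProjectionOnto ∘L J z) ⁻¹'
      Set.range ((↑) : (V ≃L[ℂ] S.1) → V →L[ℂ] S.1) with hW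
    refine ⟨W, h1.continuousOn.isOpen_inter_preimage hU ContinuousLinearEquiv.isOpen,
      ⟨hz₀U, (hmem z₀ hz₀U).1 hz₀⟩, fun z hz => (hmem z hz.1).2 hz.2, ?_⟩
    have h3 : ContMDiffOn 𝓘(ℝ, M) 𝓘(ℝ, S.1 →L[ℂ] V) ∞
        (fun z => (S.1.orthogonalProjectionOnto ∘L J z).inverse) W := by
      intro z hz
      obtain ⟨e, he⟩ := hz.2
      have h4 : ContMDiffAt 𝓘(ℝ, V →L[ℂ] S.1) 𝓘(ℝ, S.1 →L[ℂ] V) ∞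
          ContinuousLinearMap.inverse (S.1.orthogonalProjectionOnto ∘L J z) := by
        have := (contDiffAt_map_inverse (𝕜 := ℂ) (n := ∞) e).restrict_scalars ℝ
        rw [he] at this
        exact this.contMDiffAt
      exact h4.comp_contMDiffWithinAt z ((h1 z hz.1).mono Set.inter_subset_left)
    refine ((h2.mono Set.inter_subset_left).complexCLM_comp h3).congr fun z hz => ?_
    -- Being isometric, `J z` is a topological isomorphism onto its range `ζ z`, as the chart
    -- formula for parametrized subspaces demands.
    let i : V →ₗᵢ[ℂ] H := ⟨(J z : V →ₗ[ℂ] H), (hJζ z hz.1).1⟩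
    have hr : LinearMap.range i.toLinearMap = (ζ z).1 := by
      ext x
      exact ((hJζ z hz.1).2 x).symm
    let j : V ≃L[ℂ] (ζ z).1 :=
      (i.equivRange.trans (LinearIsometryEquiv.ofEq _ _ hr)).toContinuousLinearEquiv
    exact chart_eq_of_equiv S (ζ z) (J z) j (by ext; rfl)
  refine ⟨isOpen_iff_mem_nhds.2 fun z hz => ?_, fun z hz => ?_⟩
  · obtain ⟨W, hW, hzW, hWs, -⟩ := key z hz
    exact Filter.mem_of_superset (hW.mem_nhds hzW) hWs
  · obtain ⟨W, hW, hzW, -, hWc⟩ := key z hz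
    exact (hWc.contMDiffAt (hW.mem_nhds hzW)).contMDiffWithinAt

end Gr

/-! ### The kernel as a Gram kernel of the large representation -/

section HomogeneousBundle

variable {E : Type*} [NormedAddCommGroup E] [NormedSpace ℝ E]
  {G : Type*} [Group G] [TopologicalSpace G] [ChartedSpace E G] {H : Subgroup G}
  {V : Type*} [NormedAddCommGroup V] [InnerProductSpace ℂ V] [CompleteSpace V]
  {HA : Type*} [NormedAddCommGroup HA] [InnerProductSpace ℂ HA] [CompleteSpace HA]
  {HB : Submodule ℂ HA} [CompleteSpace HB]

/-- A uniformly continuous unitary representation of a Banach-Lie group is smooth. -/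
theorem UnitaryRep.contMDiff [LieGroup 𝓘(ℝ, E) ∞ G] (ρ : UnitaryRep G V) :
    ContMDiff 𝓘(ℝ, E) 𝓘(ℝ, V →L[ℂ] V) ∞ (fun g => (ρ g : V →L[ℂ] V)) :=
  MonoidHom.contMDiff_of_continuous (A := V →L[ℂ] V)
    ((unitary (V →L[ℂ] V)).subtype.comp ρ.toMonoidHom)
    (continuous_subtype_val.comp ρ.continuous_toFun)

/-- The common source of smoothness for the transition functions and for the kernel: both become
compressions along smooth group-valued maps. -/
theorem contMDiffOn_compression [LieGroup 𝓘(ℝ, E) ∞ G] (ρA : UnitaryRep G HA)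
    {EM : Type*} [NormedAddCommGroup EM] [NormedSpace ℝ EM] {HM : Type*} [TopologicalSpace HM]
    {I : ModelWithCorners ℝ EM HM} {Z : Type*} [TopologicalSpace Z] [ChartedSpace HM Z]
    {u v : Z → G} {s : Set Z} (hu : ContMDiffOn I 𝓘(ℝ, E) ∞ u s)
    (hv : ContMDiffOn I 𝓘(ℝ, E) ∞ v s) :
    ContMDiffOn I 𝓘(ℝ, HB →L[ℂ] HB) ∞ (fun z => compression ρA HB (u z) (v z)) s :=
  contMDiffOn_const.complexCLM_comp ((ρA.contMDiff.comp_contMDiffOn hu.inv).complexCLM_comp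
    ((ρA.contMDiff.comp_contMDiffOn hv).complexCLM_comp contMDiffOn_const))

theorem UnitaryRep.inner_inv_apply (ρ : UnitaryRep G V) (u : G) (x y : V) :
    inner ℂ x ((ρ u⁻¹ : V →L[ℂ] V) y) = inner ℂ ((ρ u : V →L[ℂ] V) x) y := by
  rw [← unitary_inner (ρ u) x, ← ContinuousLinearMap.comp_apply]
  have : (ρ u : V →L[ℂ] V) ∘L (ρ u⁻¹ : V →L[ℂ] V) = ((ρ (u * u⁻¹) : unitary (V →L[ℂ] V)) : V →L[ℂ] V) := by
    rw [map_mul]; rfl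
  rw [this, mul_inv_cancel, map_one]; rfl

theorem UnitaryRep.norm_apply (ρ : UnitaryRep G V) (u : G) (x : V) :
    ‖(ρ u : V →L[ℂ] V) x‖ = ‖x‖ := by
  rw [@norm_eq_sqrt_re_inner ℂ, unitary_inner, ← @norm_eq_sqrt_re_inner ℂ]

theorem inner_compression (ρA : UnitaryRep G HA) (u v : G) (f h : HB) :
    inner ℂ h (compression ρA HB u v f) =
      inner ℂ ((ρA u : HA →L[ℂ] HA) h) ((ρA v : HA →L[ℂ] HA) f) := by
  have : ∀ y : HA, inner ℂ h (HB.orthogonalProjectionOnto y) = inner ℂ (h : HA) y :=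
    fun y => by simp
  rw [← ρA.inner_inv_apply]
  exact this _

section Kernel

variable {ρA : UnitaryRep G HA} {ρB : UnitaryRep H HB}
  (hρ : ∀ (w : H) (f : HB), ((ρB w : HB →L[ℂ] HB) f : HA) = (ρA (w : G) : HA →L[ℂ] HA) f)

include hρ

/-- The cosets are free variables here, so that values of local sections, which represent their
coset only by a proved equality, can serve as representatives. -/
theorem homogeneousKernel_apply {u v : G} {s t : G ⧸ H} (hu : (u : G ⧸ H) = s)
    (hv : (v : G ⧸ H) = t) (f : HB) :
    homogeneousKernel ρA ρB s t (ρB.fiberIso v hv f) =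
      ρB.fiberIso u hu (compression ρA HB u v f) := by
  subst hu hv
  exact homogeneousKernel_mk ρA ρB hρ u v f

/-- The factorization on which the rest depends: $[(u,h)]\mapsto\rho_A(u)h$ is a feature map for the
kernel. The projection and $\rho_A(u^{-1})$ move to the other argument as adjoints. -/
theorem inner_homogeneousKernel {u v : G} {s t : G ⧸ H} (hu : (u : G ⧸ H) = s)
    (hv : (v : G ⧸ H) = t) (f h : HB) :
    inner ℂ (ρB.fiberIso u hu h) (homogeneousKernel ρA ρB s t (ρB.fiberIso v hv f)) =
      inner ℂ ((ρA u : HA →L[ℂ] HA) h) ((ρA v : HA →L[ℂ] HA) f) := by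
  rw [homogeneousKernel_apply hρ hu hv, LinearIsometryEquiv.inner_map_map, inner_compression]

/-- With one representative `u` on both sides, unitarity of $\rho_A(u)$ removes it from the scalar
product. -/
theorem homogeneousKernel_self (s : G ⧸ H) :
    homogeneousKernel ρA ρB s s = ContinuousLinearMap.id ℂ (ρB.Fiber s) := by
  obtain ⟨u, hu⟩ := QuotientGroup.mk_surjective s
  ext x
  obtain ⟨f, rfl⟩ := (ρB.fiberIso u hu).surjective x
  refine ext_inner_left ℂ fun y => ?_
  obtain ⟨h, rfl⟩ := (ρB.fiberIso u hu).surjective y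
  rw [inner_homogeneousKernel hρ hu hu, unitary_inner, ContinuousLinearMap.id_apply,
    LinearIsometryEquiv.inner_map_map]
  rfl

/-- The double sum is the squared norm of $\sum_j\rho_A(u_j)f_j$ in $\mathcal H_A$. -/
theorem isPosDef_homogeneousKernel : (homogeneousKernel ρA ρB).IsPosDef := by
  intro n t η
  choose u hu using fun j => QuotientGroup.mk_surjective (t j)
  choose f hf using fun j => (ρB.fiberIso (u j) (hu j)).surjective (η j)
  obtain rfl : η = fun j => ρB.fiberIso (u j) (hu j) (f j) := funext fun j => (hf j).symm
  simp only [inner_homogeneousKernel hρ (hu _) (hu _)]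
  simp only [← sum_inner, ← inner_sum]
  rw [inner_self_eq_norm_sq_to_K]
  rw [← RCLike.ofReal_pow]
  exact Complex.zero_le_real.2 (sq_nonneg _)

end Kernel

/-! ### Identification of the kernel's Hilbert space with the large representation space -/

section KernelSpace

variable (ρA : UnitaryRep G HA) (ρB : UnitaryRep H HB)

/-- The section `s = uH ↦ [(u, P ρ_A(u⁻¹) x)]` attached to a vector `x` of the large
representation. -/
def sectionOf : HA →ₗ[ℂ] (∀ s, ρB.Fiber s) :=
  LinearMap.pi fun s =>
    ((ρB.fiberIso _ (QuotientGroup.out_eq' s)).toLinearEquiv : HB →ₗ[ℂ] ρB.Fiber s) ∘ₗ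
      ((HB.orthogonalProjectionOnto ∘L (ρA (Quotient.out s)⁻¹ : HA →L[ℂ] HA) : HA →L[ℂ] HB) :
        HA →ₗ[ℂ] HB)

/-- The linear span of `ρ_A(G) H_B`. -/
def orbitSpan (HB : Submodule ℂ HA) : Submodule ℂ HA :=
  Submodule.span ℂ {x : HA | ∃ (u : G) (f : HB), x = (ρA u : HA →L[ℂ] HA) f}

variable {ρA ρB}
  (hρ : ∀ (w : H) (f : HB), ((ρB w : HB →L[ℂ] HB) f : HA) = (ρA (w : G) : HA →L[ℂ] HA) f)

include hρ

/-- Orbit vectors give exactly the kernel sections, so the span of the orbit maps onto the span of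
the $K_\xi$. -/
theorem sectionOf_apply {v : G} {t : G ⧸ H} (hv : (v : G ⧸ H) = t) (f : HB) :
    sectionOf ρA ρB ((ρA v : HA →L[ℂ] HA) f) =
      (homogeneousKernel ρA ρB).sectionAt t (ρB.fiberIso v hv f) := by
  funext s
  rw [BundleKernel.sectionAt_apply, homogeneousKernel_apply hρ (QuotientGroup.out_eq' s) hv]
  rfl

theorem map_sectionOf_orbitSpan :
    (orbitSpan ρA HB).map (sectionOf ρA ρB) = (homogeneousKernel ρA ρB).sectionSpan := by
  rw [orbitSpan, Submodule.map_span, BundleKernel.sectionSpan]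
  congr 1
  ext σ
  constructor
  · rintro ⟨_, ⟨u, f, rfl⟩, rfl⟩
    exact ⟨u, _, sectionOf_apply hρ rfl f⟩
  · rintro ⟨t, ξ, rfl⟩
    obtain ⟨u, hu⟩ := QuotientGroup.mk_surjective t
    obtain ⟨f, rfl⟩ := (ρB.fiberIso u hu).surjective ξ
    exact ⟨_, ⟨u, f, rfl⟩, sectionOf_apply hρ hu f⟩

/-- The restriction of `sectionOf` to the span of `ρ_A(G) H_B`, as a map into the pre-Hilbert space
of the kernel. -/
def orbitSpanMap : orbitSpan ρA HB →ₗ[ℂ] (isPosDef_homogeneousKernel hρ).PreSpace :=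
  LinearMap.codRestrict (homogeneousKernel ρA ρB).sectionSpan
    (sectionOf ρA ρB ∘ₗ (orbitSpan ρA HB).subtype) fun x => by
      rw [← map_sectionOf_orbitSpan hρ]
      exact ⟨x, x.2, rfl⟩

theorem orbitSpanMap_apply {v : G} {t : G ⧸ H} (hv : (v : G ⧸ H) = t) (f : HB)
    (h : (ρA v : HA →L[ℂ] HA) f ∈ orbitSpan ρA HB) :
    orbitSpanMap hρ ⟨_, h⟩ =
      (isPosDef_homogeneousKernel hρ).kernelSection t (ρB.fiberIso v hv f) :=
  Subtype.ext (sectionOf_apply hρ hv f)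

/-- On generators this is the Gram formula `inner_homogeneousKernel`; sesquilinearity, by induction
over the span in each variable, does the rest. -/
theorem inner_orbitSpanMap (x y : orbitSpan ρA HB) :
    inner ℂ (orbitSpanMap hρ x) (orbitSpanMap hρ y) = inner ℂ (x : HA) (y : HA) := by
  obtain ⟨x, hx⟩ := x
  obtain ⟨y, hy⟩ := y
  induction hx using Submodule.span_induction with
  | mem x hx' =>
    obtain ⟨u, f, rfl⟩ := hx'
    induction hy using Submodule.span_induction with
    | mem y hy' =>
      obtain ⟨v, h, rfl⟩ := hy'
      refine (congrArg₂ (inner ℂ) (orbitSpanMap_apply hρ rfl f _)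
        (orbitSpanMap_apply hρ rfl h _)).trans ?_
      rw [BundleKernel.IsPosDef.inner_kernelSection, inner_homogeneousKernel hρ]
    | zero =>
      have : (⟨0, (orbitSpan ρA HB).zero_mem⟩ : orbitSpan ρA HB) = 0 := rfl
      erw [this, map_zero]; simp
    | add a b ha hb iha ihb =>
      have : (⟨a + b, (orbitSpan ρA HB).add_mem ha hb⟩ : orbitSpan ρA HB) = ⟨a, ha⟩ + ⟨b, hb⟩ := rfl
      erw [this, map_add, inner_add_right, iha, ihb, inner_add_right]
    | smul c a ha iha =>
      have : (⟨c • a, (orbitSpan ρA HB).smul_mem c ha⟩ : orbitSpan ρA HB) = c • ⟨a, ha⟩ := rfl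
      erw [this, map_smul, inner_smul_right, iha, inner_smul_right]
  | zero =>
    have : (⟨0, (orbitSpan ρA HB).zero_mem⟩ : orbitSpan ρA HB) = 0 := rfl
    erw [this, map_zero]; simp
  | add a b ha hb iha ihb =>
    have : (⟨a + b, (orbitSpan ρA HB).add_mem ha hb⟩ : orbitSpan ρA HB) = ⟨a, ha⟩ + ⟨b, hb⟩ := rfl
    erw [this, map_add, inner_add_left, iha, ihb, inner_add_left]
  | smul c a ha iha =>
    have : (⟨c • a, (orbitSpan ρA HB).smul_mem c ha⟩ : orbitSpan ρA HB) = c • ⟨a, ha⟩ := rfl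
    erw [this, map_smul, inner_smul_left, iha, inner_smul_left]

theorem norm_orbitSpanMap (x : orbitSpan ρA HB) : ‖orbitSpanMap hρ x‖ = ‖(x : HA)‖ := by
  rw [@norm_eq_sqrt_re_inner ℂ, inner_orbitSpanMap, ← @norm_eq_sqrt_re_inner ℂ]

/-- `orbitSpanMap` as an isomorphism. -/
def orbitSpanEquiv : orbitSpan ρA HB ≃ₗ[ℂ] (isPosDef_homogeneousKernel hρ).PreSpace :=
  LinearEquiv.ofBijective (orbitSpanMap hρ)
    ⟨(injective_iff_map_eq_zero _).2 fun x hx => by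
        have := norm_orbitSpanMap hρ x
        rw [hx, norm_zero] at this
        exact Subtype.ext (norm_eq_zero.1 this.symm),
      fun y => by
        obtain ⟨x, hx, hxy⟩ := (map_sectionOf_orbitSpan hρ).ge y.2
        exact ⟨⟨x, hx⟩, Subtype.ext hxy⟩⟩

/-- If `ρ_A(G) H_B` spans a dense subspace, then `H_A` is isomorphic to the Hilbert space of the
kernel; the isomorphism sends `ρ_A(u) f` to `K_{[(u, f)]}`. -/
theorem exists_equiv_space (hspan : (orbitSpan ρA HB).topologicalClosure = ⊤) :
    ∃ W : HA ≃ₗᵢ[ℂ] (isPosDef_homogeneousKernel hρ).Space,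
      ∀ (v : G) (t : G ⧸ H) (hv : (v : G ⧸ H) = t) (f : HB), W ((ρA v : HA →L[ℂ] HA) f) =
        (isPosDef_homogeneousKernel hρ).toSpace t (ρB.fiberIso v hv f) := by
  have hd1 : DenseRange (orbitSpan ρA HB).subtype := by
    rw [DenseRange]
    have : Set.range (orbitSpan ρA HB).subtype = (orbitSpan ρA HB : Set HA) := by simp
    rw [this]
    exact Submodule.dense_iff_topologicalClosure_eq_top.2 hspan
  have hd2 : DenseRange ((UniformSpace.Completion.toComplL (𝕜 := ℂ)
      (E := (isPosDef_homogeneousKernel hρ).PreSpace) :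
        (isPosDef_homogeneousKernel hρ).PreSpace →ₗ[ℂ] (isPosDef_homogeneousKernel hρ).Space)) :=
    UniformSpace.Completion.denseRange_coe
  have hn : ∀ x, ‖(UniformSpace.Completion.toComplL (𝕜 := ℂ)
      (E := (isPosDef_homogeneousKernel hρ).PreSpace) :
        (isPosDef_homogeneousKernel hρ).PreSpace →ₗ[ℂ] (isPosDef_homogeneousKernel hρ).Space) (orbitSpanEquiv hρ x)‖ =
        ‖(orbitSpan ρA HB).subtype x‖ := fun x =>
    (UniformSpace.Completion.norm_coe _).trans (norm_orbitSpanMap hρ x)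
  -- An isometric bijection between dense subspaces of two complete spaces extends to a unitary;
  -- density on the side of `HA` is the spanning hypothesis.
  refine ⟨(orbitSpanEquiv hρ).extendOfIsometry _ _ hd1 hd2 hn, fun v t hv f => ?_⟩
  have hm : (ρA v : HA →L[ℂ] HA) f ∈ orbitSpan ρA HB := Submodule.subset_span ⟨v, f, rfl⟩
  have h1 := LinearEquiv.extendOfIsometry_eq (orbitSpanEquiv hρ) _ _ hd1 hd2 hn ⟨_, hm⟩
  refine h1.trans ?_
  exact congrArg _ (orbitSpanMap_apply hρ hv f hm)

end KernelSpace

end HomogeneousBundle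

/-! ### Hermitian structure, smoothness of the kernel and of its Grassmannian map -/

section AdmissibleKernel

variable {E : Type*} [NormedAddCommGroup E] [NormedSpace ℝ E] [CompleteSpace E]
  {G : Type*} [Group G] [TopologicalSpace G] [ChartedSpace E G] [LieGroup 𝓘(ℝ, E) ∞ G]
  {H : Subgroup G} [IsBanachLieSubgroup E H]
  {V : Type*} [NormedAddCommGroup V] [InnerProductSpace ℂ V] [CompleteSpace V]
  {HA : Type*} [NormedAddCommGroup HA] [InnerProductSpace ℂ HA] [CompleteSpace HA]
  {HB : Submodule ℂ HA} [CompleteSpace HB]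

/-- Together with `trivialization_symmL` this replaces the bundle's coordinate maps by the
isometries `fiberIso`, to which the kernel formulas apply. -/
theorem UnitaryRep.trivialization_continuousLinearMapAt (ρ : UnitaryRep H V) (σ : LocalSection E H)
    {s : G ⧸ H} (hs : s ∈ σ.dom) (x : ρ.Fiber s) :
    letI := ρ.fiberBundle E
    (ρ.trivialization σ).continuousLinearMapAt ℂ s x =
      (ρ.fiberIso _ (σ.mk_toFun s hs)).symm x := by
  let := ρ.fiberBundle E
  exact Trivialization.continuousLinearMapAt_apply_of_mem ℂ _ hs x

theorem UnitaryRep.trivialization_symmL (ρ : UnitaryRep H V) (σ : LocalSection E H)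
    {s : G ⧸ H} (hs : s ∈ σ.dom) (f : V) :
    letI := ρ.fiberBundle E
    (ρ.trivialization σ).symmL ℂ s f = ρ.fiberIso _ (σ.mk_toFun s hs) f := by
  let := ρ.fiberBundle E
  apply (ρ.fiberIso _ (σ.mk_toFun s hs)).symm.injective
  rw [← ρ.trivialization_continuousLinearMapAt σ hs, ← ρ.trivialization_continuousLinearMapAt σ hs]
  rw [Trivialization.continuousLinearMapAt_symmL _ hs,
    ρ.trivialization_continuousLinearMapAt σ hs, LinearIsometryEquiv.symm_apply_apply]

variable {ρA : UnitaryRep G HA} {ρB : UnitaryRep H HB}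
  (hρ : ∀ (w : H) (f : HB), ((ρB w : HB →L[ℂ] HB) f : HA) = (ρA (w : G) : HA →L[ℂ] HA) f)

include hρ

/-- The kernel read in trivializations defined by local sections. -/
theorem inTrivializations_homogeneousKernel (σ σ' : LocalSection E H) {p : (G ⧸ H) × (G ⧸ H)}
    (hp : p ∈ σ.dom ×ˢ σ'.dom) :
    letI := ρB.fiberBundle E
    letI := ρB.vectorBundle E
    letI : MemTrivializationAtlas (ρB.trivialization σ) := ⟨⟨σ, rfl⟩⟩
    letI : MemTrivializationAtlas (ρB.trivialization σ') := ⟨⟨σ', rfl⟩⟩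
    (homogeneousKernel ρA ρB).inTrivializations HB (ρB.trivialization σ) (ρB.trivialization σ') p =
      compression ρA HB (σ.toFun p.1) (σ'.toFun p.2) := by
  let := ρB.fiberBundle E
  let := ρB.vectorBundle E
  let : MemTrivializationAtlas (ρB.trivialization σ) := ⟨⟨σ, rfl⟩⟩
  let : MemTrivializationAtlas (ρB.trivialization σ') := ⟨⟨σ', rfl⟩⟩
  ext1 f
  refine (ρB.trivialization_continuousLinearMapAt σ hp.1 _).trans ?_
  have h := (congrArg (homogeneousKernel ρA ρB p.1 p.2) (ρB.trivialization_symmL σ' hp.2 f)).trans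
    (homogeneousKernel_apply hρ (σ.mk_toFun p.1 hp.1) (σ'.mk_toFun p.2 hp.2) f)
  exact (congrArg (ρB.fiberIso _ (σ.mk_toFun p.1 hp.1)).symm h).trans
    (LinearIsometryEquiv.symm_apply_apply _ _)

/-- The transition functions of the homogeneous bundle. -/
theorem coordChangeL_trivialization (σ σ' : LocalSection E H) {s : G ⧸ H}
    (hs : s ∈ σ.dom ∩ σ'.dom) :
    letI := ρB.fiberBundle E
    ((ρB.trivialization σ).coordChangeL ℂ (ρB.trivialization σ') s : HB →L[ℂ] HB) =
      compression ρA HB (σ'.toFun s) (σ.toFun s) := by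
  let := ρB.fiberBundle E
  ext1 f
  change (ρB.trivialization σ).coordChangeL ℂ (ρB.trivialization σ') s f = _
  rw [Trivialization.coordChangeL_apply _ _ hs]
  refine (ρB.coord_eq σ' hs.2 _).trans ?_
  have h1 : (ρB.trivialization σ).symm s f = ρB.fiberIso _ (σ.mk_toFun s hs.1) f :=
    (Trivialization.symmL_apply (R := ℂ) _ hs.1 f).symm.trans (ρB.trivialization_symmL σ hs.1 f)
  -- Changing the representative from $\sigma(s)$ to $\sigma'(s)$ is the kernel formula on the
  -- diagonal, where $K(s,s)=\mathrm{id}$. This expresses $\rho_B(\sigma'(s)^{-1}\sigma(s))$ through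
  -- $\rho_A$, which is already known to be smooth.
  have h2 := homogeneousKernel_apply hρ (σ'.mk_toFun s hs.2) (σ.mk_toFun s hs.1) f
  rw [homogeneousKernel_self hρ] at h2
  exact (congrArg (ρB.fiberIso _ (σ'.mk_toFun s hs.2)).symm (h1.trans h2)).trans
    (LinearIsometryEquiv.symm_apply_apply _ _)

/-- The transition functions are compressions along smooth sections. The trivializations are
fiberwise isometric, so in each of them the scalar product is the constant one of $\mathcal H_B$. -/
theorem isHermitianBundle_homogeneous :
    letI := ρB.fiberBundle E
    letI := ρB.vectorBundle E
    IsHermitianBundle (M := quotientModel E H) HB ρB.Fiber := by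
  let := ρB.fiberBundle E
  let := ρB.vectorBundle E
  refine ⟨?_, fun s => ?_, ?_⟩
  · rintro _ _ ⟨σ, rfl⟩ ⟨σ', rfl⟩
    exact (contMDiffOn_compression ρA (σ'.smooth.mono Set.inter_subset_right)
      (σ.smooth.mono Set.inter_subset_left)).congr fun s hs => coordChangeL_trivialization hρ σ σ' hs
  · exact (ρB.fiberIso _ (QuotientGroup.out_eq' s)).toIsometryEquiv.completeSpace_iff.1
      inferInstance
  · rintro _ ⟨σ, rfl⟩
    have h : ContMDiff (𝓘(ℝ, quotientModel E H).prod (𝓘(ℝ, HB).prod 𝓘(ℝ, HB))) 𝓘(ℝ, ℂ) ∞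
        (fun q : (G ⧸ H) × HB × HB => inner ℂ q.2.2 q.2.1) :=
      (contDiff_inner (𝕜 := ℂ)).contMDiff.comp
        (contMDiff_snd.snd.prodMk_space contMDiff_snd.fst)
    refine h.contMDiffOn.congr fun q hq => ?_
    rw [ρB.trivialization_symmL σ hq.1, ρB.trivialization_symmL σ hq.1,
      LinearIsometryEquiv.inner_map_map]

theorem contMDiffOn_inTrivializations_homogeneousKernel :
    letI := ρB.fiberBundle E
    letI := ρB.vectorBundle E
    ∀ (e e' : Trivialization HB (π HB ρB.Fiber)) [MemTrivializationAtlas e]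
      [MemTrivializationAtlas e'],
      ContMDiffOn (𝓘(ℝ, quotientModel E H).prod 𝓘(ℝ, quotientModel E H)) 𝓘(ℝ, HB →L[ℂ] HB) ∞
        ((homogeneousKernel ρA ρB).inTrivializations HB e e') (e.baseSet ×ˢ e'.baseSet) := by
  let := ρB.fiberBundle E
  let := ρB.vectorBundle E
  rintro _ _ ⟨σ, rfl⟩ ⟨σ', rfl⟩
  refine (contMDiffOn_compression ρA (σ.smooth.comp contMDiffOn_fst fun p hp => hp.1)
    (σ'.smooth.comp contMDiffOn_snd fun p hp => hp.2)).congr fun p hp => ?_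
  exact inTrivializations_homogeneousKernel hρ σ σ' hp

/-- Under the unitary `W`, the fiber over `s` becomes $\rho_A(\sigma(s))\mathcal H_B$, the range of
an isometry that depends smoothly on `s`. -/
theorem isSmoothMap_zeta (hspan : (orbitSpan ρA HB).topologicalClosure = ⊤) :
    Gr.IsSmoothMap (M := quotientModel E H) (isPosDef_homogeneousKernel hρ).zeta := by
  obtain ⟨W, hW⟩ := exists_equiv_space hρ hspan
  refine Gr.isSmoothMap_of_isometry (V := HB) fun s₀ => ?_
  obtain ⟨σ, hσ⟩ := LocalSection.exists_mem (E := E) s₀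
  have hWn : ∀ s f, ‖W ((ρA (σ.toFun s) : HA →L[ℂ] HA) (f : HB))‖ = ‖f‖ := fun s f => by
    rw [W.norm_map, ρA.norm_apply]; rfl
  let J : G ⧸ H → HB →L[ℂ] (isPosDef_homogeneousKernel hρ).Space := fun s =>
    (W.toContinuousLinearEquiv : HA →L[ℂ] (isPosDef_homogeneousKernel hρ).Space) ∘L
      (ρA (σ.toFun s) : HA →L[ℂ] HA) ∘L HB.subtypeL
  refine ⟨σ.dom, σ.isOpen_dom, hσ, J, ?_, fun s hs => ⟨hWn s, ?_⟩⟩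
  · exact contMDiffOn_const.complexCLM_comp ((ρA.contMDiff.comp_contMDiffOn σ.smooth).complexCLM_comp
      contMDiffOn_const)
  · let i : HB →ₗᵢ[ℂ] (isPosDef_homogeneousKernel hρ).Space := ⟨(J s).toLinearMap, hWn s⟩
    have hr : LinearMap.range ((isPosDef_homogeneousKernel hρ).toSpace s) =
        LinearMap.range i.toLinearMap := by
      ext x
      constructor
      · rintro ⟨ξ, rfl⟩
        obtain ⟨f, rfl⟩ := (ρB.fiberIso _ (σ.mk_toFun s hs)).surjective ξ
        exact ⟨f, hW _ s (σ.mk_toFun s hs) f⟩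
      · rintro ⟨f, rfl⟩
        exact ⟨_, (hW _ s (σ.mk_toFun s hs) f).symm⟩
    -- The isometric image of a complete space is closed, so the closure in the definition of `zeta`
    -- adds nothing.
    have hc : IsClosed (LinearMap.range i.toLinearMap : Set (isPosDef_homogeneousKernel hρ).Space) :=
      i.isometry.isClosedEmbedding.isClosed_range
    have hz : ((isPosDef_homogeneousKernel hρ).zeta s).1 = LinearMap.range i.toLinearMap := by
      change (LinearMap.range ((isPosDef_homogeneousKernel hρ).toSpace s)).topologicalClosure = _
      rw [hr]
      exact hc.submodule_topologicalClosure_eq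
    intro x
    rw [hz]
    rfl

end AdmissibleKernel

end

/-! ### The main theorem -/

theorem proposition5p2 {E : Type*} [NormedAddCommGroup E] [NormedSpace ℝ E] [CompleteSpace E]
    {GA : Type*} [Group GA] [TopologicalSpace GA] [ChartedSpace E GA] [LieGroup 𝓘(ℝ, E) ∞ GA]
    (GB : Subgroup GA) [IsBanachLieSubgroup E GB]
    {HA : Type*} [NormedAddCommGroup HA] [InnerProductSpace ℂ HA] [CompleteSpace HA]
    (HB : Submodule ℂ HA) [CompleteSpace HB]
    (ρA : UnitaryRep GA HA) (ρB : UnitaryRep GB HB)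
    (hρ : ∀ (w : GB) (f : HB), ((ρB w : HB →L[ℂ] HB) f : HA) = (ρA (w : GA) : HA →L[ℂ] HA) f)
    (hspan : (Submodule.span ℂ
      {x : HA | ∃ (u : GA) (f : HB), x = (ρA u : HA →L[ℂ] HA) f}).topologicalClosure = ⊤) :
    letI : FiberBundle HB ρB.Fiber := ρB.fiberBundle E
    letI : VectorBundle ℂ HB ρB.Fiber := ρB.vectorBundle E
    IsHermitianBundle (M := quotientModel E GB) HB ρB.Fiber ∧
      (∀ (u v : GA) (f : HB), homogeneousKernel ρA ρB u v (ρB.fiberIso v rfl f) =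
        ρB.fiberIso u rfl (HB.orthogonalProjectionOnto
          ((ρA u⁻¹ : HA →L[ℂ] HA) ((ρA v : HA →L[ℂ] HA) f)))) ∧
      IsAdmissibleKernel (M := quotientModel E GB) HB (homogeneousKernel ρA ρB) ∧
      ∀ s : GA ⧸ GB, homogeneousKernel ρA ρB s s = ContinuousLinearMap.id ℂ (ρB.Fiber s) := by
  let _ := ρB.fiberBundle E
  let _ := ρB.vectorBundle E
  have hsm := contMDiffOn_inTrivializations_homogeneousKernel (E := E) hρ
  exact ⟨isHermitianBundle_homogeneous hρ, homogeneousKernel_mk ρA ρB hρ,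
    { continuous_section := fun e e' _ _ => (hsm e e').continuousOn
      posDef := isPosDef_homogeneousKernel hρ
      smooth_section := fun e e' _ _ => hsm e e'
      isUnit_diag := fun s => by
        rw [homogeneousKernel_self hρ]; exact isUnit_one
      smooth_zeta := isSmoothMap_zeta hρ hspan },
    homogeneousKernel_self hρ⟩
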